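/- Let $q\in L_2(0,\pi)$ be complex-valued and consider the boundary value problem with frozen argument $$-y''(x)+q(x)\,y\!\left(\tfrac{\pi}{2}\right)=\lambda y(x),\quad x\in(0,\pi),\qquad y(0)=y(\pi)=0 ,$$ with solutions $y\in W_2^2(0,\pi)$. Put $a=\frac{\pi}{2}$ and $\lambda=\rho^2$, and let $$C(x,\lambda)=\cos(\rho(x-a))+\int_a^x q(t)\,\frac{\sin(\rho(x-t))}{\rho}\,dt,\qquad S(x,\lambda)=\frac{\sin(\rho(x-a))}{\rho},$$ $$\Delta(\lambda)=C(0,\lambda)S(\pi,\lambda)-S(0,\lambda)C(\pi,\lambda)$$ (with the continuous extension to $\rho=0$). The multiplicity of an eigenvalue is its order as a zero of the characteristic function $\Delta$. Let $\{\lambda_n\}_{n=1}^{\infty}$ be the eigenvalues of the problem, each repeated according to its multiplicity, numbered so that $|\lambda_n|\le|\lambda_{n+1}|$ for all sufficiently large $n$. Then there is a sequence $\{\varkappa_n\}\in l_2$ of complex numbers such that, for every odd $n\ge 1$, $$\lambda_n=n^2+\frac{2\sin\frac{n\pi}{2}}{\pi}\int_0^{\pi/2}p(t)\sin(nt)\,dt+\frac{\varkappa_n}{n},\qquad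 p(t):=q(t)+q(\pi-t).$$ -/

import Mathlib

namespace FrozenArgument

open MeasureTheory

noncomputable section

/-- `y` belongs to the Sobolev space `W₂²(0, π)` with first derivative `dy` and second derivative
`ddy`: `y` and `dy` are absolutely continuous on `[0, π]`, with derivatives `dy` and
`ddy ∈ L₂(0, π)` respectively. -/
structure IsW22 (y dy ddy : ℝ → ℂ) : Prop where
  memLp : MemLp ddy 2 (volume.restrict (Set.Ioo 0 Real.pi))
  eq_integral : ∀ x ∈ Set.Icc 0 Real.pi, y x = y 0 + ∫ t in (0 : ℝ)..x, dy t
  deriv_eq_integral : ∀ x ∈ Set.Icc 0 Real.pi, dy x = dy 0 + ∫ t in (0 : ℝ)..x, ddy t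

/-- `z` is an eigenvalue of the boundary value problem
`-y''(x) + q(x) y(a) = z y(x)` for `x ∈ (0, π)`, `y(0) = y(π) = 0`:
there is a solution in `W₂²(0, π)` that is not identically zero on `[0, π]`. -/
def IsEigenvalue (q : ℝ → ℂ) (a : ℝ) (z : ℂ) : Prop :=
  ∃ y dy ddy : ℝ → ℂ, IsW22 y dy ddy ∧
    (∀ᵐ x ∂(volume.restrict (Set.Ioo 0 Real.pi)), -ddy x + q x * y a = z * y x) ∧
    y 0 = 0 ∧ y Real.pi = 0 ∧ ∃ x ∈ Set.Icc 0 Real.pi, y x ≠ 0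

/-- A square root `ρ` of the spectral parameter (the functions below do not depend on the choice
of the branch). -/
def rho (z : ℂ) : ℂ := z ^ (1 / 2 : ℂ)

/-- `sin (ρ x) / ρ` where `ρ ^ 2 = z`, with its limit value `x` at `z = 0`. -/
def sinDiv (z : ℂ) (x : ℝ) : ℂ :=
  if z = 0 then (x : ℂ) else Complex.sin (rho z * x) / rho z

/-- The solution `S` of the equation with `S(a) = 0`, `S'(a) = 1`. -/
def solS (a : ℝ) (x : ℝ) (z : ℂ) : ℂ := sinDiv z (x - a)

/-- The solution `C` of the equation with `C(a) = 1`, `C'(a) = 0`. -/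
def solC (q : ℝ → ℂ) (a : ℝ) (x : ℝ) (z : ℂ) : ℂ :=
  Complex.cos (rho z * (x - a : ℝ)) + ∫ t in a..x, q t * sinDiv z (x - t)

/-- The characteristic function `Δ(z) = C(0, z) S(π, z) - S(0, z) C(π, z)`. -/
def charDelta (q : ℝ → ℂ) (a : ℝ) (z : ℂ) : ℂ :=
  Matrix.det !![solC q a 0 z, solS a 0 z; solC q a Real.pi z, solS a Real.pi z]

open Classical in
/-- The (algebraic) multiplicity of `z` as an eigenvalue: its order as a zero of the
characteristic function; it is `0` if `z` is not an eigenvalue. -/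
def eigMultiplicity (q : ℝ → ℂ) (a : ℝ) (z : ℂ) : ℕ∞ :=
  if IsEigenvalue q a z then analyticOrderAt (charDelta q a) z else 0

/-- `lam 1, lam 2, …` is a numbering of the spectrum: every eigenvalue occurs as often as its
multiplicity says, nothing else occurs, and `|lam n|` is nondecreasing from some index on.
(The last condition fixes the numbering up to a permutation of finitely many indices; the value
`lam 0` plays no role.) -/
structure IsSpectrumNumbering (q : ℝ → ℂ) (a : ℝ) (lam : ℕ → ℂ) : Prop where
  count : ∀ z : ℂ, {n : ℕ | 1 ≤ n ∧ lam n = z}.encard = eigMultiplicity q a z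
  eventually_monotone : ∀ᶠ n : ℕ in Filter.atTop, ‖lam n‖ ≤ ‖lam (n + 1)‖

end

end FrozenArgument

/-! Put `z = ρ ^ 2`. Reflection about the midpoint `π / 2` factors the characteristic function
(`charDelta_eq`) as `sin (ρ π / 2) / ρ` times `2 cos (ρ π / 2) + ∫ p(t) sin (ρ t) / ρ dt`. The first
factor vanishes only at squares of positive even integers, so the eigenvalues with large odd index
come from the second, that is, from `2 ρ cos (ρ π / 2) + P(ρ) = 0`, where `P` is the finite sine
transform of `p`.

Two things must be shown. The index must match: Rouché's theorem on `|z| = (N + 1/2) ^ 2`, comparing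
`Δ` with `sin (ρ π) / ρ`, leaves exactly `N` eigenvalues inside for large `N`. Since the moduli are
eventually nondecreasing, `lam n` lies in the annulus between the radii `(n - 1/2) ^ 2` and `(n +
1/2) ^ 2` (`eventually_norm_mem_annulus`). For this count, zeros of `Δ` have to be genuine
eigenvalues (`isEigenvalue_of_charDelta_eq_zero`).

The remainder must be square summable. For large odd `n` the equation gives a square root `w = n +
e` of `lam n` with `e = O(1/n)` (`exists_root_near_odd`). With `σ = sin (n π / 2) = ±1` it reads
`P(w) = 2 σ w sin (π e / 2)`, so `w ^ 2 - n ^ 2 ≈ 2 n e ≈ (2 σ / π) P(n)`. The error is `O(|e|)`,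
and the equation itself improves `n |e| = O(1)` to `n |e| = O(|P(n)| + 1/n)`
(`norm_sq_sub_le_of_cos_eq`). Hence `n` times the error is in `l_2` by Bessel's inequality
(`summable_norm_sineTransform_sq`). -/

namespace FrozenArgument

/-! ### Argument principle and Rouché's theorem for entire functions -/

open Metric Set

/-- An entire function with a zero of finite order `n` at `b` factors as `(z - b) ^ n * h z`. -/
theorem exists_entire_factor {f : ℂ → ℂ} (hf : Differentiable ℂ f) (b : ℂ)
    (hb : analyticOrderAt f b ≠ ⊤) :
    ∃ h : ℂ → ℂ, Differentiable ℂ h ∧ h b ≠ 0 ∧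
      ∀ z, f z = (z - b) ^ analyticOrderNatAt f b * h z := by
  have key : ∀ n : ℕ, ∀ f : ℂ → ℂ, Differentiable ℂ f → analyticOrderAt f b = n →
      ∃ h : ℂ → ℂ, Differentiable ℂ h ∧ h b ≠ 0 ∧ ∀ z, f z = (z - b) ^ n * h z := by
    intro n
    induction n with
    | zero =>
      intro f hf h0
      refine ⟨f, hf, ?_, by simp⟩
      simpa [(hf.analyticAt b).analyticOrderAt_eq_zero] using h0
    | succ n ih =>
      intro f hf hn
      have hfb : f b = 0 := by
        apply apply_eq_zero_of_analyticOrderAt_ne_zero (𝕜 := ℂ)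
        rw [hn]; simp
      have hd : Differentiable ℂ (dslope f b) := by
        have := (Complex.differentiableOn_dslope (f := f) (s := univ) (c := b) Filter.univ_mem).2
          hf.differentiableOn
        exact differentiableOn_univ.1 this
      have hfac : f = (fun z => z - b) * dslope f b := by
        funext z
        have := sub_smul_dslope f b z
        simp [hfb] at this
        simp [this]
      have ho : analyticOrderAt (dslope f b) b = n := by
        have h1 : analyticOrderAt f b
            = analyticOrderAt (fun z : ℂ => z - b) b + analyticOrderAt (dslope f b) b := by
          conv_lhs => rw [hfac]
          exact analyticOrderAt_mul (by fun_prop) (hd.analyticAt b)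
        have h2 : analyticOrderAt (fun z : ℂ => z - b) b = 1 := analyticOrderAt_id_sub_const_self
        rw [hn, h2] at h1
        push_cast at h1
        rw [add_comm] at h1
        exact (by simpa [add_comm] using h1 : (n : ℕ∞) = _).symm
      obtain ⟨h, hh, hhb, hz⟩ := ih _ hd ho
      refine ⟨h, hh, hhb, fun z => ?_⟩
      rw [hfac]
      simp only [Pi.mul_apply, hz z]
      ring
  exact key _ f hf (Nat.cast_analyticOrderNatAt hb).symm

/-- The argument principle for entire functions. -/
theorem circleIntegral_logDeriv_eq_sum {R : ℝ} (hR : 0 < R) (c : ℂ) (Z : Finset ℂ) :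
    ∀ f : ℂ → ℂ, Differentiable ℂ f → (∀ a ∈ Z, a ∈ ball c R) →
      (∀ a ∈ Z, analyticOrderAt f a ≠ ⊤) →
      (∀ z ∈ closedBall c R, f z = 0 → z ∈ Z) →
      (∮ z in C(c, R), logDeriv f z) =
        2 * Real.pi * Complex.I * (∑ a ∈ Z, analyticOrderNatAt f a : ℕ) := by
  induction Z using Finset.induction_on with
  | empty =>
    intro f hf _ _ h0
    have hd : DifferentiableOn ℂ (logDeriv f) (closedBall c R) := by
      intro z hz
      have hfz : f z ≠ 0 := fun h => by simpa using h0 z hz h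
      exact (((hf.analyticAt z).deriv.differentiableAt).div hf.differentiableAt hfz).differentiableWithinAt
    simp only [Finset.sum_empty, Nat.cast_zero, mul_zero]
    exact Complex.circleIntegral_eq_zero_of_differentiable_on_off_countable hR.le
      countable_empty hd.continuousOn
      (fun z hz => (hd z (ball_subset_closedBall hz.1)).differentiableAt
        (closedBall_mem_nhds_of_mem hz.1))
  | insert b Z hbZ ih =>
    intro f hf hball hord h0
    obtain ⟨h, hh, hhb, hz⟩ := exists_entire_factor hf b (hord b (by simp))
    set n := analyticOrderNatAt f b with hn
    have hfac : f = (fun z => (z - b) ^ n) * h := funext hz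
    have hbb : b ∈ ball c R := hball b (by simp)
    have horda : ∀ a ∈ Z, analyticOrderAt f a = analyticOrderAt h a := by
      intro a ha
      have hab : a ≠ b := fun e => hbZ (e ▸ ha)
      conv_lhs => rw [hfac]
      rw [analyticOrderAt_mul (by fun_prop) (hh.analyticAt a)]
      have : analyticOrderAt (fun z : ℂ => (z - b) ^ n) a = 0 := by
        rw [AnalyticAt.analyticOrderAt_eq_zero (by fun_prop)]
        exact pow_ne_zero _ (sub_ne_zero.2 hab)
      rw [this, zero_add]
    have hhz : ∀ z ∈ closedBall c R, h z = 0 → z ∈ Z := by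
      intro z hzR hz0
      have := h0 z hzR (by rw [hz z, hz0, mul_zero])
      rcases Finset.mem_insert.1 this with rfl | h'
      · exact absurd hz0 hhb
      · exact h'
    have IH := ih h hh (fun a ha => hball a (Finset.mem_insert_of_mem ha))
      (fun a ha => by rw [← horda a ha]; exact hord a (Finset.mem_insert_of_mem ha)) hhz
    have hsph : ∀ z ∈ sphere c R, z - b ≠ 0 ∧ h z ≠ 0 := by
      intro z hzs
      constructor
      · intro e
        rw [sub_eq_zero] at e
        subst e
        rw [mem_ball] at hbb; rw [mem_sphere] at hzs
        linarith
      · intro e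
        have := hball z (Finset.mem_insert_of_mem (hhz z (sphere_subset_closedBall hzs) e))
        rw [mem_ball] at this; rw [mem_sphere] at hzs
        linarith
    -- Splitting off `(z - b) ^ n` adds `n / (z - b)` to the logarithmic derivative; the cofactor
    -- `h` keeps the other zeros with their orders.
    have hld : ∀ z ∈ sphere c R, logDeriv f z = (n : ℂ) • (z - b)⁻¹ + logDeriv h z := by
      intro z hzs
      rw [hfac]
      have h1 := logDeriv_mul (f := fun z : ℂ => (z - b) ^ n) (g := h) z
        (pow_ne_zero _ (hsph z hzs).1) (hsph z hzs).2 (by fun_prop) hh.differentiableAt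
      refine h1.trans ?_
      congr 1
      rw [logDeriv_fun_pow (by fun_prop)]
      simp [logDeriv_apply]
    rw [circleIntegral.integral_congr hR.le hld]
    have hc1 : CircleIntegrable (fun z => (n : ℂ) • (z - b)⁻¹) c R := by
      apply ContinuousOn.circleIntegrable hR.le
      exact (ContinuousOn.inv₀ (f := fun z => z - b) (by fun_prop)
        (fun z hzs => (hsph z hzs).1)).const_smul (n : ℂ)
    have hc2 : CircleIntegrable (logDeriv h) c R := by
      apply ContinuousOn.circleIntegrable hR.le
      intro z hzs
      exact (((hh.analyticAt z).deriv.differentiableAt).div hh.differentiableAt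
        (hsph z hzs).2).continuousAt.continuousWithinAt
    rw [circleIntegral.integral_add hc1 hc2, IH, circleIntegral.integral_smul,
      circleIntegral.integral_sub_inv_of_mem_ball hbb, Finset.sum_insert hbZ,
      Finset.sum_congr rfl (fun a ha => show analyticOrderNatAt h a = analyticOrderNatAt f a by
        simp only [analyticOrderNatAt, horda a ha])]
    push_cast
    simp only [smul_eq_mul]
    ring

/-- **Rouché's theorem** for entire functions. -/
theorem sum_order_eq_of_norm_sub_lt {R : ℝ} (hR : 0 < R) (c : ℂ) {f g : ℂ → ℂ}
    (hf : Differentiable ℂ f) (hg : Differentiable ℂ g)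
    (hfg : ∀ z ∈ sphere c R, ‖f z - g z‖ < ‖g z‖) {Zf Zg : Finset ℂ}
    (hZf : ∀ z, z ∈ Zf ↔ z ∈ ball c R ∧ f z = 0)
    (hZg : ∀ z, z ∈ Zg ↔ z ∈ ball c R ∧ g z = 0) :
    ∑ a ∈ Zf, analyticOrderNatAt f a = ∑ a ∈ Zg, analyticOrderNatAt g a := by
  have hg0 : ∀ z ∈ sphere c R, g z ≠ 0 := fun z hz h => by
    have := hfg z hz
    rw [h, norm_zero] at this
    exact absurd this (not_lt.2 (norm_nonneg _))
  have hf0 : ∀ z ∈ sphere c R, f z ≠ 0 := fun z hz h => by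
    have := hfg z hz
    rw [h, zero_sub, norm_neg] at this
    exact lt_irrefl _ this
  have hord : ∀ k : ℂ → ℂ, Differentiable ℂ k → (∀ z ∈ sphere c R, k z ≠ 0) →
      ∀ a, analyticOrderAt k a ≠ ⊤ := by
    intro k hk hk0 a htop
    have hz0 : c + R ∈ sphere c R := by simp [abs_of_pos hR]
    have hk' : AnalyticOnNhd ℂ k univ := fun z _ => hk.analyticAt z
    have h2 := hk'.eqOn_zero_of_preconnected_of_eventuallyEq_zero isPreconnected_univ
      (mem_univ a) (analyticOrderAt_eq_top.1 htop)
    exact hk0 _ hz0 (h2 (mem_univ _))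
  have hcl : ∀ k : ℂ → ℂ, (∀ z ∈ sphere c R, k z ≠ 0) → ∀ z ∈ closedBall c R, k z = 0 →
      z ∈ ball c R := by
    intro k hk z hz hkz
    rw [← ball_union_sphere] at hz
    exact hz.resolve_right fun h => hk z h hkz
  have If := circleIntegral_logDeriv_eq_sum hR c Zf f hf (fun a ha => ((hZf a).1 ha).1)
    (fun a _ => hord f hf hf0 a) (fun z hz h => (hZf z).2 ⟨hcl f hf0 z hz h, h⟩)
  have Ig := circleIntegral_logDeriv_eq_sum hR c Zg g hg (fun a ha => ((hZg a).1 ha).1)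
    (fun a _ => hord g hg hg0 a) (fun z hz h => (hZg z).2 ⟨hcl g hg0 z hz h, h⟩)
  have hci : ∀ k : ℂ → ℂ, Differentiable ℂ k → (∀ z ∈ sphere c R, k z ≠ 0) →
      CircleIntegrable (logDeriv k) c R := by
    intro k hk hk0
    apply ContinuousOn.circleIntegrable hR.le
    intro z hzs
    exact (((hk.analyticAt z).deriv.differentiableAt).div hk.differentiableAt
      (hk0 z hzs)).continuousAt.continuousWithinAt
  -- On the circle `f / g` stays in the disc of radius 1 about 1, so the principal logarithm of `f /
  -- g` is a single-valued primitive of the difference.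
  have hdiff : (∮ z in C(c, R), (logDeriv f z - logDeriv g z)) = 0 := by
    apply circleIntegral.integral_eq_zero_of_hasDerivWithinAt hR.le
      (f := fun z => Complex.log (f z / g z))
    intro z hz
    have hs : f z / g z ∈ Complex.slitPlane := by
      apply Complex.ball_one_subset_slitPlane
      rw [mem_ball, dist_eq_norm, div_sub_one (hg0 z hz), norm_div,
        div_lt_one (norm_pos_iff.2 (hg0 z hz))]
      exact hfg z hz
    have hq := (hf.differentiableAt (x := z)).hasDerivAt.div
      (hg.differentiableAt (x := z)).hasDerivAt (hg0 z hz)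
    have h1 := hf0 z hz
    have h2 := hg0 z hz
    refine (hq.clog hs).hasDerivWithinAt.congr_deriv ?_
    rw [logDeriv_apply, logDeriv_apply, Pi.div_apply]
    field_simp
  rw [circleIntegral.integral_sub (hci f hf hf0) (hci g hg hg0), If, Ig, sub_eq_zero] at hdiff
  have h2 : (2 * Real.pi * Complex.I : ℂ) ≠ 0 := by simp [Real.pi_ne_zero]
  exact_mod_cast mul_left_cancel₀ h2 hdiff

end FrozenArgument

/-! ### Functions of the square root of the spectral parameter; the sine transform -/

namespace FrozenArgument

open MeasureTheory Filter Topology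

theorem rho_sq (z : ℂ) : rho z ^ 2 = z := by
  have := Complex.cpow_nat_inv_pow z (n := 2) (by norm_num)
  simpa only [rho, Nat.cast_ofNat, one_div] using this

theorem norm_rho_sq (z : ℂ) : ‖rho z‖ ^ 2 = ‖z‖ := by
  rw [← norm_pow, rho_sq]

theorem rho_eq_zero_iff {z : ℂ} : rho z = 0 ↔ z = 0 := by
  constructor
  · intro h
    rw [← rho_sq z, h]
    simp
  · rintro rfl
    simp [rho]

theorem rho_eq_or_eq_neg {z w : ℂ} (h : w ^ 2 = z) : rho z = w ∨ rho z = -w := by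
  apply sq_eq_sq_iff_eq_or_eq_neg.1
  rw [rho_sq, h]

/-- An even entire function of `√z` is an entire function of `z`. -/
theorem differentiable_comp_rho {G : ℂ → ℂ} (hG : Differentiable ℂ G)
    (heven : ∀ w, G (-w) = G w) : Differentiable ℂ fun z => G (rho z) := by
  have hne : ∀ z₀ : ℂ, z₀ ≠ 0 → DifferentiableAt ℂ (fun z => G (rho z)) z₀ := by
    intro z₀ hz₀
    -- This square root is analytic near `z₀`, even when `z₀` lies on the branch cut of `rho`; it
    -- agrees with `rho` up to a sign, which evenness absorbs.
    have hr : ∀ z : ℂ, (rho z₀ * (z / z₀) ^ (1 / 2 : ℂ)) ^ 2 = z := by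
      intro z
      have h := rho_sq (z / z₀)
      rw [rho] at h
      rw [mul_pow, h, rho_sq]
      field_simp
    have heq : (fun z => G (rho z)) = fun z => G (rho z₀ * (z / z₀) ^ (1 / 2 : ℂ)) := by
      funext z
      rcases rho_eq_or_eq_neg (hr z) with h | h
      · rw [h]
      · rw [h, heven]
    rw [heq]
    refine (hG _).comp z₀ (DifferentiableAt.const_mul ?_ _)
    refine DifferentiableAt.cpow_const (by fun_prop) ?_
    simp [div_self hz₀, Complex.one_mem_slitPlane]
  -- At the branch point continuity suffices, since the singularity is then removable.
  have hcont : ContinuousAt (fun z => G (rho z)) 0 := by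
    have h0 : Tendsto rho (𝓝 0) (𝓝 0) := by
      rw [tendsto_zero_iff_norm_tendsto_zero]
      have h1 : (fun z : ℂ => ‖rho z‖) = fun z => Real.sqrt ‖z‖ := by
        funext z
        rw [← norm_rho_sq z, Real.sqrt_sq (norm_nonneg _)]
      rw [h1]
      have : Continuous fun z : ℂ => Real.sqrt ‖z‖ := by fun_prop
      simpa using this.tendsto 0
    have h2 : rho 0 = 0 := rho_eq_zero_iff.2 rfl
    have : Tendsto (fun z => G (rho z)) (𝓝 0) (𝓝 (G (rho 0))) := by
      rw [h2]
      exact (hG.continuous.tendsto 0).comp h0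
    exact this
  have := (Complex.differentiableOn_compl_singleton_and_continuousAt_iff
    (f := fun z => G (rho z)) (s := Set.univ) (c := 0) Filter.univ_mem).1
    ⟨fun z hz => (hne z (by simpa using hz)).differentiableWithinAt, hcont⟩
  exact differentiableOn_univ.1 this

/-- The form without denominators, which avoids a case distinction at `z = 0`. -/
theorem rho_mul_sinDiv (z : ℂ) (x : ℝ) : rho z * sinDiv z x = Complex.sin (rho z * x) := by
  unfold sinDiv
  split_ifs with h
  · simp [rho_eq_zero_iff.2 h]
  · have := mt rho_eq_zero_iff.1 h
    field_simp

theorem sinDiv_neg (z : ℂ) (x : ℝ) : sinDiv z (-x) = -sinDiv z x := by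
  unfold sinDiv
  split_ifs <;> simp [neg_div]

@[simp] theorem sinDiv_zero (z : ℂ) : sinDiv z 0 = 0 := by
  unfold sinDiv
  split_ifs <;> simp

theorem sinDiv_add_self (z : ℂ) (x : ℝ) :
    sinDiv z (x + x) = sinDiv z x * (2 * Complex.cos (rho z * x)) := by
  unfold sinDiv
  split_ifs with h
  · simp [rho_eq_zero_iff.2 h]; ring
  · push_cast
    rw [mul_add, ← two_mul, Complex.sin_two_mul]
    ring

theorem hasDerivAt_sinDiv (z : ℂ) (x : ℝ) :
    HasDerivAt (fun x : ℝ => sinDiv z x) (Complex.cos (rho z * x)) x := by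
  unfold sinDiv
  split_ifs with h
  · simpa [rho_eq_zero_iff.2 h] using (hasDerivAt_id x).ofReal_comp
  · have hr := mt rho_eq_zero_iff.1 h
    have h1 : HasDerivAt (fun x : ℝ => rho z * (x : ℂ)) (rho z * 1) x :=
      ((hasDerivAt_id x).ofReal_comp).const_mul _
    refine (((Complex.hasDerivAt_sin (rho z * x)).comp x h1).div_const (rho z)).congr_deriv ?_
    field_simp

theorem hasDerivAt_cos_rho (z : ℂ) (x : ℝ) :
    HasDerivAt (fun x : ℝ => Complex.cos (rho z * x)) (-(z * sinDiv z x)) x := by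
  have h1 : HasDerivAt (fun x : ℝ => rho z * (x : ℂ)) (rho z * 1) x :=
    ((hasDerivAt_id x).ofReal_comp).const_mul _
  refine ((Complex.hasDerivAt_cos (rho z * x)).comp x h1).congr_deriv ?_
  rw [← rho_mul_sinDiv]
  linear_combination -(sinDiv z x) * rho_sq z

theorem continuous_sinDiv (z : ℂ) : Continuous fun x : ℝ => sinDiv z x :=
  continuous_iff_continuousAt.2 fun x => (hasDerivAt_sinDiv z x).continuousAt

theorem continuous_cos_rho (z : ℂ) : Continuous fun x : ℝ => Complex.cos (rho z * x) :=
  continuous_iff_continuousAt.2 fun x => (hasDerivAt_cos_rho z x).continuousAt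

/-- The finite sine transform of `p` on `[0, a]`. -/
noncomputable def sineTransform (p : ℝ → ℂ) (a : ℝ) (w : ℂ) : ℂ :=
  ∫ t in (0 : ℝ)..a, p t * Complex.sin (w * t)

theorem norm_sin_le_exp_abs_im (w : ℂ) : ‖Complex.sin w‖ ≤ Real.exp |w.im| := by
  rw [Complex.sin, norm_div, norm_mul, Complex.norm_I, mul_one]
  have h1 : ‖Complex.exp (-w * Complex.I)‖ ≤ Real.exp |w.im| := by
    rw [Complex.norm_exp]
    apply Real.exp_le_exp.2
    simpa using le_abs_self w.im
  have h2 : ‖Complex.exp (w * Complex.I)‖ ≤ Real.exp |w.im| := by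
    rw [Complex.norm_exp]
    apply Real.exp_le_exp.2
    simpa using neg_le_abs w.im
  have := norm_sub_le (Complex.exp (-w * Complex.I)) (Complex.exp (w * Complex.I))
  simp only [Complex.norm_ofNat]
  linarith

theorem norm_cos_le_exp_abs_im (w : ℂ) : ‖Complex.cos w‖ ≤ Real.exp |w.im| := by
  have := norm_sin_le_exp_abs_im (w + (Real.pi / 2 : ℝ))
  push_cast at this
  rw [Complex.sin_add_pi_div_two] at this
  have h2 : (w + (Real.pi : ℂ) / 2).im = w.im := by
    have : ((Real.pi : ℂ) / 2) = ((Real.pi / 2 : ℝ) : ℂ) := by push_cast; rfl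
    rw [this, Complex.add_im, Complex.ofReal_im, add_zero]
  rwa [h2] at this

section SineTransform

variable {p : ℝ → ℂ} {a : ℝ}

theorem exp_abs_im_mul_le {w : ℂ} {t : ℝ} (ha : 0 ≤ a) (ht : t ∈ Set.uIoc 0 a) :
    Real.exp |(w * t).im| ≤ Real.exp (|w.im| * a) := by
  rw [Set.uIoc_of_le ha] at ht
  apply Real.exp_le_exp.2
  rw [Complex.im_mul_ofReal, abs_mul, abs_of_pos ht.1]
  exact mul_le_mul_of_nonneg_left ht.2 (abs_nonneg _)

theorem norm_sineTransform_le (ha : 0 ≤ a) (hp : IntervalIntegrable p volume 0 a) (w : ℂ) :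
    ‖sineTransform p a w‖ ≤ (∫ t in (0 : ℝ)..a, ‖p t‖) * Real.exp (|w.im| * a) := by
  rw [sineTransform, ← intervalIntegral.integral_mul_const]
  apply intervalIntegral.norm_integral_le_of_norm_le ha _ (hp.norm.mul_const _)
  filter_upwards with t ht
  rw [norm_mul]
  refine mul_le_mul_of_nonneg_left ?_ (norm_nonneg _)
  exact (norm_sin_le_exp_abs_im _).trans (exp_abs_im_mul_le ha (by rwa [Set.uIoc_of_le ha]))

theorem hasDerivAt_sineTransform (ha : 0 ≤ a) (hp : IntervalIntegrable p volume 0 a) (w : ℂ) :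
    HasDerivAt (sineTransform p a) (∫ t in (0 : ℝ)..a, p t * (t * Complex.cos (w * t))) w := by
  have hmeas : ∀ g : ℝ → ℂ, Continuous g →
      AEStronglyMeasurable (fun t => p t * g t) (volume.restrict (Set.uIoc 0 a)) := fun g hg =>
    hp.def'.aestronglyMeasurable.mul hg.aestronglyMeasurable
  have := intervalIntegral.hasDerivAt_integral_of_dominated_loc_of_deriv_le
    (μ := volume) (a := 0) (b := a) (s := Metric.ball w 1) (x₀ := w)
    (F := fun w t => p t * Complex.sin (w * t))
    (F' := fun w t => p t * (t * Complex.cos (w * t)))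
    -- On the unit ball about `w` the imaginary part is at most `|w.im| + 1` in modulus, which
    -- bounds the cosine uniformly.
    (bound := fun t => ‖p t‖ * (a * Real.exp ((|w.im| + 1) * a)))
    (Metric.ball_mem_nhds w one_pos)
    (Eventually.of_forall fun v => hmeas _ (by fun_prop))
    (hp.mul_continuousOn (by fun_prop))
    (hmeas _ (by fun_prop)) ?_ (hp.norm.mul_const _) ?_
  · exact this.2
  · filter_upwards with t ht v hv
    rw [norm_mul, norm_mul]
    have ht' := ht
    rw [Set.uIoc_of_le ha] at ht'
    refine mul_le_mul_of_nonneg_left ?_ (norm_nonneg _)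
    refine mul_le_mul ?_ ?_ (norm_nonneg _) ha
    · simpa [abs_of_pos ht'.1] using ht'.2
    · refine (norm_cos_le_exp_abs_im _).trans ((exp_abs_im_mul_le ha ht).trans ?_)
      apply Real.exp_le_exp.2
      refine mul_le_mul_of_nonneg_right ?_ ha
      have h1 : |(v - w).im| ≤ 1 := (Complex.abs_im_le_norm _).trans (by
        rw [← dist_eq_norm]; exact (Metric.mem_ball.1 hv).le)
      have h2 : |v.im| ≤ |w.im| + |(v - w).im| := by
        have := abs_add_le w.im (v - w).im
        simpa using this
      linarith
  · filter_upwards with t ht v hv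
    have h1 : HasDerivAt (fun v : ℂ => v * (t : ℂ)) (1 * (t : ℂ)) v :=
      (hasDerivAt_id v).mul_const _
    refine ((h1.csin).const_mul (p t)).congr_deriv ?_
    rw [one_mul, mul_comm (Complex.cos _)]

theorem differentiable_sineTransform (ha : 0 ≤ a) (hp : IntervalIntegrable p volume 0 a) :
    Differentiable ℂ (sineTransform p a) := fun w =>
  (hasDerivAt_sineTransform ha hp w).differentiableAt

theorem sineTransform_zero : sineTransform p a 0 = 0 := by simp [sineTransform]

theorem sineTransform_neg (w : ℂ) : sineTransform p a (-w) = -sineTransform p a w := by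
  simp [sineTransform, neg_mul]

/-- The sine transform is Lipschitz on unit balls centred on the real axis, uniformly in the
centre. -/
theorem exists_norm_sineTransform_sub_le (ha : 0 ≤ a) (hp : IntervalIntegrable p volume 0 a) :
    ∃ K : ℝ, 0 ≤ K ∧ ∀ (x : ℝ) (w : ℂ), ‖w - x‖ ≤ 1 →
      ‖sineTransform p a w - sineTransform p a x‖ ≤ K * ‖w - x‖ := by
  refine ⟨(∫ t in (0 : ℝ)..a, ‖p t‖ * (a * Real.exp a)), ?_, fun x w hw => ?_⟩
  · exact intervalIntegral.integral_nonneg ha fun t _ => by positivity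
  refine (convex_closedBall (x : ℂ) 1).norm_image_sub_le_of_norm_deriv_le (𝕜 := ℂ)
    (fun v _ => differentiable_sineTransform ha hp v) ?_ (by simp)
    (by simpa [dist_eq_norm] using hw)
  intro v hv
  rw [(hasDerivAt_sineTransform ha hp v).deriv]
  apply intervalIntegral.norm_integral_le_of_norm_le ha _ (hp.norm.mul_const _)
  filter_upwards with t ht
  rw [norm_mul, norm_mul]
  refine mul_le_mul_of_nonneg_left ?_ (norm_nonneg _)
  refine mul_le_mul ?_ ?_ (norm_nonneg _) ha
  · simpa [abs_of_pos ht.1] using ht.2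
  · refine (norm_cos_le_exp_abs_im _).trans
      ((exp_abs_im_mul_le ha (by rwa [Set.uIoc_of_le ha])).trans ?_)
    apply Real.exp_le_exp.2
    have h1 : |v.im| ≤ 1 := by
      have := Complex.abs_im_le_norm (v - x)
      rw [Complex.sub_im, Complex.ofReal_im, sub_zero, ← dist_eq_norm] at this
      exact this.trans (Metric.mem_closedBall.1 hv)
    nlinarith

/-- `sineTransform p a w / w` as an even entire function of `w`. -/
theorem integral_mul_sinDiv (ha : 0 ≤ a) (hp : IntervalIntegrable p volume 0 a) (z : ℂ) :
    (∫ t in (0 : ℝ)..a, p t * sinDiv z t) = dslope (sineTransform p a) 0 (rho z) := by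
  by_cases hz : z = 0
  · subst hz
    rw [rho_eq_zero_iff.2 rfl, dslope_same, (hasDerivAt_sineTransform ha hp 0).deriv]
    simp [sinDiv]
  · have hr := mt rho_eq_zero_iff.1 hz
    rw [dslope_of_ne _ hr, slope_def_field, sineTransform_zero, sub_zero, sub_zero, sineTransform,
      ← intervalIntegral.integral_div]
    simp [sinDiv, hz, mul_div_assoc]

theorem dslope_zero_neg_of_odd {G : ℂ → ℂ} (hodd : ∀ w, G (-w) = -G w) (w : ℂ) :
    dslope G 0 (-w) = dslope G 0 w := by
  by_cases hw : w = 0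
  · simp [hw]
  · have h0 : G 0 = 0 := by
      have := hodd 0
      rw [neg_zero] at this
      exact self_eq_neg.1 this
    rw [dslope_of_ne _ hw, dslope_of_ne _ (neg_ne_zero.2 hw), slope_def_field, slope_def_field,
      h0, hodd]
    simp

theorem differentiable_dslope {G : ℂ → ℂ} (hG : Differentiable ℂ G) (c : ℂ) :
    Differentiable ℂ (dslope G c) :=
  differentiableOn_univ.1 ((Complex.differentiableOn_dslope (s := Set.univ)
    Filter.univ_mem).2 hG.differentiableOn)

/-- The integral is `G(ρ) / ρ` with `G` odd and entire, hence an even entire function of `ρ`. -/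
theorem differentiable_integral_mul_sinDiv (ha : 0 ≤ a) (hp : IntervalIntegrable p volume 0 a) :
    Differentiable ℂ fun z => ∫ t in (0 : ℝ)..a, p t * sinDiv z t := by
  simp only [integral_mul_sinDiv ha hp]
  exact differentiable_comp_rho (differentiable_dslope (differentiable_sineTransform ha hp) 0)
    (dslope_zero_neg_of_odd sineTransform_neg)

end SineTransform

theorem differentiable_sinDiv (x : ℝ) : Differentiable ℂ fun z => sinDiv z x := by
  have hd : Differentiable ℂ fun w : ℂ => Complex.sin (w * x) := by fun_prop
  have h : (fun z => sinDiv z x) = fun z => dslope (fun w => Complex.sin (w * x)) 0 (rho z) := by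
    funext z
    by_cases hz : z = 0
    · subst hz
      rw [rho_eq_zero_iff.2 rfl, dslope_same]
      have h1 : HasDerivAt (fun v : ℂ => v * (x : ℂ)) (1 * (x : ℂ)) 0 :=
        (hasDerivAt_id 0).mul_const _
      rw [h1.csin.deriv]
      simp [sinDiv]
    · have hr := mt rho_eq_zero_iff.1 hz
      rw [dslope_of_ne _ hr, slope_def_field]
      simp [sinDiv, hz]
  rw [h]
  exact differentiable_comp_rho (differentiable_dslope hd 0)
    (dslope_zero_neg_of_odd fun w => by simp [neg_mul])

theorem differentiable_cos_rho (x : ℝ) : Differentiable ℂ fun z => Complex.cos (rho z * x) :=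
  differentiable_comp_rho (G := fun w => Complex.cos (w * x)) (by fun_prop)
    (fun w => by rw [neg_mul, Complex.cos_neg])

/-! ### Factorization of the characteristic function -/

section CharDelta

variable {q : ℝ → ℂ}

theorem intervalIntegrable_of_memLp
    (hq : MemLp q 2 (volume.restrict (Set.Ioo 0 Real.pi))) {x y : ℝ}
    (hx : x ∈ Set.Icc 0 Real.pi) (hy : y ∈ Set.Icc 0 Real.pi) :
    IntervalIntegrable q volume x y := by
  have h1 : IntegrableOn q (Set.Ioo 0 Real.pi) := hq.integrable (by norm_num)
  have h2 : IntervalIntegrable q volume 0 Real.pi :=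
    (intervalIntegrable_iff_integrableOn_Ioo_of_le Real.pi_pos.le).2 h1
  apply h2.mono_set
  rw [Set.uIcc_of_le Real.pi_pos.le]
  exact Set.uIcc_subset_Icc hx hy

theorem intervalIntegrable_reflect
    (hq : MemLp q 2 (volume.restrict (Set.Ioo 0 Real.pi))) :
    IntervalIntegrable (fun t => q (Real.pi - t)) volume 0 (Real.pi / 2) := by
  have hpi := Real.pi_pos
  have := (intervalIntegrable_of_memLp hq (x := Real.pi) (y := Real.pi / 2)
    ⟨by linarith, le_rfl⟩ ⟨by linarith, by linarith⟩).comp_sub_left Real.pi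
  simpa [sub_half] using this

theorem intervalIntegrable_symm
    (hq : MemLp q 2 (volume.restrict (Set.Ioo 0 Real.pi))) :
    IntervalIntegrable (fun t => q t + q (Real.pi - t)) volume 0 (Real.pi / 2) := by
  have hpi := Real.pi_pos
  exact (intervalIntegrable_of_memLp hq ⟨le_rfl, hpi.le⟩ ⟨by linarith, by linarith⟩).add
    (intervalIntegrable_reflect hq)

/-- Since `π / 2` is the midpoint, `S(0) = -S(π)` and `Δ = S(π) (C(0) + C(π))`. Substituting `t ↦ π
- t` in `C(π)` gives both integrals the kernel `sinDiv z t`, and only the symmetrized `q` survives.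
-/
theorem charDelta_eq (hq : MemLp q 2 (volume.restrict (Set.Ioo 0 Real.pi))) (z : ℂ) :
    charDelta q (Real.pi / 2) z = sinDiv z (Real.pi / 2) *
      (2 * Complex.cos (rho z * (Real.pi / 2 : ℝ)) +
        ∫ t in (0 : ℝ)..(Real.pi / 2), (q t + q (Real.pi - t)) * sinDiv z t) := by
  have hpi := Real.pi_pos
  have hC0 : solC q (Real.pi / 2) 0 z = Complex.cos (rho z * (Real.pi / 2 : ℝ)) +
      ∫ t in (0 : ℝ)..(Real.pi / 2), q t * sinDiv z t := by
    rw [solC, intervalIntegral.integral_symm]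
    congr 1
    · rw [zero_sub, Complex.ofReal_neg, mul_neg, Complex.cos_neg]
    · rw [← intervalIntegral.integral_neg]
      congr 1
      funext t
      rw [zero_sub, sinDiv_neg, mul_neg, neg_neg]
  have hCpi : solC q (Real.pi / 2) Real.pi z = Complex.cos (rho z * (Real.pi / 2 : ℝ)) +
      ∫ t in (0 : ℝ)..(Real.pi / 2), q (Real.pi - t) * sinDiv z t := by
    rw [solC]
    congr 1
    · rw [sub_half]
    · have := intervalIntegral.integral_comp_sub_left (a := 0) (b := Real.pi / 2)
        (fun t => q t * sinDiv z (Real.pi - t)) Real.pi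
      simp only [sub_sub_cancel, sub_zero, sub_half] at this
      exact this.symm
  have hadd : (∫ t in (0 : ℝ)..(Real.pi / 2), (q t + q (Real.pi - t)) * sinDiv z t) =
      (∫ t in (0 : ℝ)..(Real.pi / 2), q t * sinDiv z t) +
        ∫ t in (0 : ℝ)..(Real.pi / 2), q (Real.pi - t) * sinDiv z t := by
    rw [← intervalIntegral.integral_add]
    · simp only [add_mul]
    · exact (intervalIntegrable_of_memLp hq ⟨le_rfl, hpi.le⟩
        ⟨by linarith, by linarith⟩).mul_continuousOn (continuous_sinDiv z).continuousOn
    · exact (intervalIntegrable_reflect hq).mul_continuousOn (continuous_sinDiv z).continuousOn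
  rw [charDelta, Matrix.det_fin_two_of, hC0, hCpi, hadd, solS, solS, zero_sub, sinDiv_neg, sub_half]
  ring

theorem differentiable_charDelta (hq : MemLp q 2 (volume.restrict (Set.Ioo 0 Real.pi))) :
    Differentiable ℂ (charDelta q (Real.pi / 2)) := by
  rw [funext (charDelta_eq hq)]
  exact (differentiable_sinDiv _).mul (((differentiable_cos_rho _).const_mul 2).add
    (differentiable_integral_mul_sinDiv (by positivity) (intervalIntegrable_symm hq)))

end CharDelta

end FrozenArgument

/-! ### Fubini on a triangle and the variation of constants formula -/

namespace FrozenArgument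

open MeasureTheory Filter Topology

/-- Interchange of the order of integration over a triangle. -/
theorem integral_triangle_swap {lo hi : ℝ} (h : lo ≤ hi) {g : ℝ → ℝ → ℂ}
    (hg : Integrable (Function.uncurry g)
      ((volume.restrict (Set.Ioc lo hi)).prod (volume.restrict (Set.Ioc lo hi)))) :
    ∫ u in lo..hi, ∫ t in lo..u, g t u = ∫ t in lo..hi, ∫ u in t..hi, g t u := by
  set T : Set (ℝ × ℝ) := {x | x.1 ≤ x.2} with hT
  have hTm : MeasurableSet T := measurableSet_le measurable_fst measurable_snd
  have hG : Integrable (Function.uncurry fun t u => T.indicator (Function.uncurry g) (t, u))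
      ((volume.restrict (Set.Ioc lo hi)).prod (volume.restrict (Set.Ioc lo hi))) :=
    hg.indicator hTm
  have hswap := integral_integral_swap hG
  rw [intervalIntegral.integral_of_le h, intervalIntegral.integral_of_le h]
  have h1 : ∀ u ∈ Set.Ioc lo hi, ∫ t in lo..u, g t u =
      ∫ t in Set.Ioc lo hi, T.indicator (Function.uncurry g) (t, u) := by
    intro u hu
    have : (fun t => T.indicator (Function.uncurry g) (t, u)) =
        (Set.Iic u).indicator fun t => g t u := by
      funext t
      by_cases htu : t ≤ u <;> simp [hT, Set.indicator, htu]
    rw [this, integral_indicator measurableSet_Iic, Measure.restrict_restrict measurableSet_Iic,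
      intervalIntegral.integral_of_le hu.1.le]
    congr 2
    ext t
    simp only [Set.mem_Ioc, Set.mem_inter_iff, Set.mem_Iic]
    exact ⟨fun ht => ⟨ht.2, ht.1, ht.2.trans hu.2⟩, fun ht => ⟨ht.2.1, ht.1⟩⟩
  have h2 : ∀ t ∈ Set.Ioc lo hi, ∫ u in t..hi, g t u =
      ∫ u in Set.Ioc lo hi, T.indicator (Function.uncurry g) (t, u) := by
    intro t ht
    have : (fun u => T.indicator (Function.uncurry g) (t, u)) =
        (Set.Ici t).indicator fun u => g t u := by
      funext u
      by_cases htu : t ≤ u <;> simp [hT, Set.indicator, htu]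
    rw [this, integral_indicator measurableSet_Ici, Measure.restrict_restrict measurableSet_Ici,
      intervalIntegral.integral_of_le ht.2, ← integral_Icc_eq_integral_Ioc]
    congr 2
    ext u
    simp only [Set.mem_Icc, Set.mem_Ioc, Set.mem_inter_iff, Set.mem_Ici]
    exact ⟨fun hu => ⟨hu.1, ht.1.trans_le hu.1, hu.2⟩, fun hu => ⟨hu.1, hu.2.2⟩⟩
  rw [setIntegral_congr_fun measurableSet_Ioc h1, setIntegral_congr_fun measurableSet_Ioc h2]
  exact hswap.symm

theorem integrable_mul_comp_sub {q k : ℝ → ℂ} {lo hi : ℝ}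
    (hq : IntegrableOn q (Set.Ioc lo hi)) (hk : Continuous k) :
    Integrable (Function.uncurry fun t u => q t * k (u - t))
      ((volume.restrict (Set.Ioc lo hi)).prod (volume.restrict (Set.Ioc lo hi))) := by
  obtain ⟨B, hB⟩ := (isCompact_Icc (a := lo - hi) (b := hi - lo)).exists_bound_of_continuousOn
    hk.continuousOn
  have h1 : Integrable (fun x : ℝ × ℝ => q x.1)
      ((volume.restrict (Set.Ioc lo hi)).prod (volume.restrict (Set.Ioc lo hi))) :=
    Integrable.comp_fst hq _
  refine h1.mul_bdd (c := B) (g := fun x : ℝ × ℝ => k (x.2 - x.1)) ?_ ?_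
  · exact (by fun_prop : Continuous fun x : ℝ × ℝ => k (x.2 - x.1)).aestronglyMeasurable
  · rw [Measure.prod_restrict]
    filter_upwards [ae_restrict_mem (measurableSet_Ioc.prod measurableSet_Ioc)] with x hx
    apply hB
    have h1 := hx.1
    have h2 := hx.2
    simp only [Set.mem_Ioc] at h1 h2
    constructor <;> linarith

/-- This replaces differentiation under the integral sign in `C` by an identity of integrals. Both
orders of `a` and `x` occur because the frozen point is interior. -/
theorem integral_mul_primitive {q k : ℝ → ℂ} {a x : ℝ} (hq : IntervalIntegrable q volume a x)
    (hk : Continuous k) :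
    ∫ t in a..x, q t * (∫ u in t..x, k (u - t)) = ∫ u in a..x, ∫ t in a..u, q t * k (u - t) := by
  rcases le_total a x with h | h
  · rw [integral_triangle_swap h (integrable_mul_comp_sub hq.1 hk)]
    simp only [intervalIntegral.integral_const_mul]
  · have hint := (integrable_mul_comp_sub hq.2 hk).swap
    have := integral_triangle_swap h (g := fun u t => q t * k (u - t)) hint
    simp only [intervalIntegral.integral_const_mul] at this
    rw [intervalIntegral.integral_symm, intervalIntegral.integral_symm x a]
    congr 1
    have h1 : ∀ t, (∫ u in t..x, k (u - t)) = -∫ u in x..t, k (u - t) := fun t =>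
      intervalIntegral.integral_symm _ _
    have h2 : ∀ u, (∫ t in a..u, q t * k (u - t)) = -∫ t in u..a, q t * k (u - t) := fun t =>
      intervalIntegral.integral_symm _ _
    simp only [h1, h2, mul_neg, intervalIntegral.integral_neg, this]

theorem sinDiv_sub (z : ℂ) (x t : ℝ) :
    sinDiv z (x - t) = sinDiv z x * Complex.cos (rho z * t) -
      Complex.cos (rho z * x) * sinDiv z t := by
  unfold sinDiv
  split_ifs with h
  · simp [rho_eq_zero_iff.2 h]
  · push_cast
    rw [mul_sub, Complex.sin_sub]
    ring

theorem cos_rho_sub (z : ℂ) (x t : ℝ) :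
    Complex.cos (rho z * (x - t : ℝ)) = Complex.cos (rho z * x) * Complex.cos (rho z * t) +
      z * (sinDiv z x * sinDiv z t) := by
  push_cast
  rw [mul_sub, Complex.cos_sub, ← rho_mul_sinDiv, ← rho_mul_sinDiv]
  linear_combination (sinDiv z x * sinDiv z t) * rho_sq z

theorem integral_cos_rho_sub (z : ℂ) (t x : ℝ) :
    ∫ u in t..x, Complex.cos (rho z * (u - t : ℝ)) = sinDiv z (x - t) := by
  have h : ∀ u ∈ Set.uIcc t x, HasDerivAt (fun u : ℝ => sinDiv z (u - t))
      (Complex.cos (rho z * (u - t : ℝ))) u := fun u _ =>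
    (hasDerivAt_sinDiv z (u - t)).comp_sub_const u t
  rw [intervalIntegral.integral_eq_sub_of_hasDerivAt h]
  · simp
  · exact ((continuous_cos_rho z).comp (continuous_sub_right t)).intervalIntegrable _ _

theorem integral_sinDiv_sub (z : ℂ) (t x : ℝ) :
    ∫ u in t..x, -(z * sinDiv z (u - t)) = Complex.cos (rho z * (x - t : ℝ)) - 1 := by
  have h : ∀ u ∈ Set.uIcc t x, HasDerivAt (fun u : ℝ => Complex.cos (rho z * (u - t : ℝ)))
      (-(z * sinDiv z (u - t))) u := fun u _ =>
    (hasDerivAt_cos_rho z (u - t)).comp_sub_const u t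
  rw [intervalIntegral.integral_eq_sub_of_hasDerivAt h]
  · simp
  · exact (((continuous_sinDiv z).comp (continuous_sub_right t)).const_mul z).neg.intervalIntegrable
      _ _

/-! ### Zeros of the characteristic function are eigenvalues -/

section Solutions

variable {q : ℝ → ℂ} {a : ℝ}

/-- The derivative of `solC q a · z`. -/
noncomputable def derivSolC (q : ℝ → ℂ) (a x : ℝ) (z : ℂ) : ℂ :=
  -(z * sinDiv z (x - a)) + ∫ t in a..x, q t * Complex.cos (rho z * (x - t : ℝ))

theorem uIcc_zero_pi : Set.uIcc 0 Real.pi = Set.Icc 0 Real.pi := Set.uIcc_of_le Real.pi_pos.le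

theorem continuousOn_primitive_mul (hq : MemLp q 2 (volume.restrict (Set.Ioo 0 Real.pi)))
    (ha : a ∈ Set.Icc 0 Real.pi) {k : ℝ → ℂ} (hk : Continuous k) :
    ContinuousOn (fun x => ∫ t in a..x, q t * k t) (Set.Icc 0 Real.pi) := by
  have hi := intervalIntegrable_of_memLp hq (x := 0) (y := Real.pi) ⟨le_rfl, Real.pi_pos.le⟩
    ⟨Real.pi_pos.le, le_rfl⟩
  have := intervalIntegral.continuousOn_primitive_interval' (a := a)
    (hi.mul_continuousOn hk.continuousOn) (by rwa [uIcc_zero_pi])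
  rwa [uIcc_zero_pi] at this

/-- The addition formula separates `x` from `t` in the kernel, leaving continuous functions times
primitives of integrable ones. -/
theorem continuousOn_solC (hq : MemLp q 2 (volume.restrict (Set.Ioo 0 Real.pi)))
    (ha : a ∈ Set.Icc 0 Real.pi) (z : ℂ) :
    ContinuousOn (fun x => solC q a x z) (Set.Icc 0 Real.pi) := by
  have heq : ∀ x ∈ Set.Icc 0 Real.pi, solC q a x z = Complex.cos (rho z * (x - a : ℝ)) +
      (sinDiv z x * (∫ t in a..x, q t * Complex.cos (rho z * t)) -
        Complex.cos (rho z * x) * ∫ t in a..x, q t * sinDiv z t) := by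
    intro x hx
    have hi := intervalIntegrable_of_memLp hq ha hx
    rw [solC, ← intervalIntegral.integral_const_mul, ← intervalIntegral.integral_const_mul,
      ← intervalIntegral.integral_sub]
    · congr 2
      funext t
      rw [sinDiv_sub]
      ring
    · exact (hi.mul_continuousOn (continuous_cos_rho z).continuousOn).const_mul _
    · exact (hi.mul_continuousOn (continuous_sinDiv z).continuousOn).const_mul _
  refine ContinuousOn.congr ?_ heq
  exact ((continuous_cos_rho z).comp (continuous_sub_right a)).continuousOn.add
    (((continuous_sinDiv z).continuousOn.mul
      (continuousOn_primitive_mul hq ha (continuous_cos_rho z))).sub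
    ((continuous_cos_rho z).continuousOn.mul
      (continuousOn_primitive_mul hq ha (continuous_sinDiv z))))

theorem continuousOn_derivSolC (hq : MemLp q 2 (volume.restrict (Set.Ioo 0 Real.pi)))
    (ha : a ∈ Set.Icc 0 Real.pi) (z : ℂ) :
    ContinuousOn (fun x => derivSolC q a x z) (Set.Icc 0 Real.pi) := by
  have heq : ∀ x ∈ Set.Icc 0 Real.pi, derivSolC q a x z = -(z * sinDiv z (x - a)) +
      (Complex.cos (rho z * x) * (∫ t in a..x, q t * Complex.cos (rho z * t)) +
        (z * sinDiv z x) * ∫ t in a..x, q t * sinDiv z t) := by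
    intro x hx
    have hi := intervalIntegrable_of_memLp hq ha hx
    rw [derivSolC, ← intervalIntegral.integral_const_mul, ← intervalIntegral.integral_const_mul,
      ← intervalIntegral.integral_add]
    · congr 2
      funext t
      rw [cos_rho_sub]
      ring
    · exact (hi.mul_continuousOn (continuous_cos_rho z).continuousOn).const_mul _
    · exact (hi.mul_continuousOn (continuous_sinDiv z).continuousOn).const_mul _
  refine ContinuousOn.congr ?_ heq
  exact ((((continuous_sinDiv z).comp (continuous_sub_right a)).const_mul z).neg).continuousOn.add
    (((continuous_cos_rho z).continuousOn.mul
      (continuousOn_primitive_mul hq ha (continuous_cos_rho z))).add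
    (((continuous_sinDiv z).const_mul z).continuousOn.mul
      (continuousOn_primitive_mul hq ha (continuous_sinDiv z))))

theorem intervalIntegrable_of_continuousOn {f : ℝ → ℂ} (hf : ContinuousOn f (Set.Icc 0 Real.pi))
    {x y : ℝ} (hx : x ∈ Set.Icc 0 Real.pi) (hy : y ∈ Set.Icc 0 Real.pi) :
    IntervalIntegrable f volume x y :=
  (hf.mono (Set.uIcc_subset_Icc hx hy)).intervalIntegrable

theorem solC_self (z : ℂ) : solC q a a z = 1 := by simp [solC]

theorem derivSolC_self (z : ℂ) : derivSolC q a a z = 0 := by simp [derivSolC]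

theorem solC_eq_integral (hq : MemLp q 2 (volume.restrict (Set.Ioo 0 Real.pi)))
    (ha : a ∈ Set.Icc 0 Real.pi) (z : ℂ) {x : ℝ} (hx : x ∈ Set.Icc 0 Real.pi) :
    solC q a x z = solC q a a z + ∫ u in a..x, derivSolC q a u z := by
  have hi := intervalIntegrable_of_memLp hq ha hx
  have hs : Continuous fun u : ℝ => -(z * sinDiv z (u - a)) :=
    (((continuous_sinDiv z).comp (continuous_sub_right a)).const_mul z).neg
  have h1 := integral_mul_primitive hi (continuous_cos_rho z)
  simp only [integral_cos_rho_sub] at h1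
  have hJ : IntervalIntegrable (fun u => ∫ t in a..u, q t * Complex.cos (rho z * (u - t : ℝ)))
      volume a x := by
    have := (intervalIntegrable_of_continuousOn (continuousOn_derivSolC hq ha z) ha hx).sub
      (hs.intervalIntegrable a x)
    simpa [derivSolC] using this
  simp only [derivSolC]
  rw [intervalIntegral.integral_add (hs.intervalIntegrable a x) hJ, integral_sinDiv_sub, ← h1,
    solC_self, solC]
  ring

theorem derivSolC_eq_integral (hq : MemLp q 2 (volume.restrict (Set.Ioo 0 Real.pi)))
    (ha : a ∈ Set.Icc 0 Real.pi) (z : ℂ) {x : ℝ} (hx : x ∈ Set.Icc 0 Real.pi) :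
    derivSolC q a x z = derivSolC q a a z + ∫ u in a..x, (q u - z * solC q a u z) := by
  have hi := intervalIntegrable_of_memLp hq ha hx
  have hc : Continuous fun u : ℝ => Complex.cos (rho z * (u - a : ℝ)) :=
    (continuous_cos_rho z).comp (continuous_sub_right a)
  have hs : Continuous fun t : ℝ => sinDiv z (x - t) :=
    (continuous_sinDiv z).comp (continuous_const.sub continuous_id)
  have h1 := integral_mul_primitive hi (continuous_sinDiv z)
  have hC := intervalIntegrable_of_continuousOn (continuousOn_solC hq ha z) ha hx
  have hI : IntervalIntegrable (fun u => ∫ t in a..u, q t * sinDiv z (u - t)) volume a x := by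
    have := hC.sub (hc.intervalIntegrable a x)
    simpa [solC] using this
  have h2 : ∀ t, -(z * ∫ u in t..x, sinDiv z (u - t)) = Complex.cos (rho z * (x - t : ℝ)) - 1 := by
    intro t
    rw [← integral_sinDiv_sub, intervalIntegral.integral_neg, intervalIntegral.integral_const_mul]
  have hci : IntervalIntegrable (fun t => q t * Complex.cos (rho z * (x - t : ℝ))) volume a x :=
    hi.mul_continuousOn
      ((continuous_cos_rho z).comp (continuous_const.sub continuous_id)).continuousOn
  -- Integrate `cos = 1 - z ∫ sinDiv` against `q` and swap the order: the constant 1 produces the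
  -- term `q` of the equation.
  have h3 : ∫ t in a..x, q t * Complex.cos (rho z * (x - t : ℝ)) =
      (∫ t in a..x, q t) - z * ∫ u in a..x, ∫ t in a..u, q t * sinDiv z (u - t) := by
    rw [← h1, eq_sub_iff_add_eq, ← eq_sub_iff_add_eq', ← intervalIntegral.integral_sub hi hci,
      ← intervalIntegral.integral_const_mul]
    congr 1
    funext t
    linear_combination (-q t) * h2 t
  have h4 : z * ∫ u in a..x, Complex.cos (rho z * (u - a : ℝ)) = z * sinDiv z (x - a) := by
    rw [integral_cos_rho_sub]
  rw [intervalIntegral.integral_sub hi (hC.const_mul z), intervalIntegral.integral_const_mul]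
  simp only [solC]
  rw [intervalIntegral.integral_add (hc.intervalIntegrable a x) hI, derivSolC_self, derivSolC, h3]
  linear_combination h4

/-- `C` and `S` are normalized at `a`, whereas `IsW22` integrates from `0`. -/
theorem eq_add_integral_zero {f f' : ℝ → ℂ}
    (hf' : ∀ x ∈ Set.Icc 0 Real.pi, IntervalIntegrable f' volume a x)
    (h : ∀ x ∈ Set.Icc 0 Real.pi, f x = f a + ∫ u in a..x, f' u) :
    ∀ x ∈ Set.Icc 0 Real.pi, f x = f 0 + ∫ u in (0 : ℝ)..x, f' u := by
  intro x hx
  have h0 : (0 : ℝ) ∈ Set.Icc 0 Real.pi := ⟨le_rfl, Real.pi_pos.le⟩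
  rw [h x hx, h 0 h0, add_assoc,
    intervalIntegral.integral_add_adjacent_intervals (hf' 0 h0)
      ((hf' 0 h0).symm.trans (hf' x hx))]

/-- Zeros of the characteristic function are eigenvalues. -/
theorem isEigenvalue_of_charDelta_eq_zero
    (hq : MemLp q 2 (volume.restrict (Set.Ioo 0 Real.pi))) (ha : a ∈ Set.Ioo 0 Real.pi)
    {z : ℂ} (hz : charDelta q a z = 0) : IsEigenvalue q a z := by
  have ha' : a ∈ Set.Icc 0 Real.pi := Set.Ioo_subset_Icc_self ha
  -- A kernel vector of the boundary matrix gives the coefficients of a combination of `C` and `S`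
  -- that vanishes at both endpoints.
  obtain ⟨v, hv0, hv⟩ := Matrix.exists_mulVec_eq_zero_iff.2 hz
  have hv1 := congrFun hv 0
  have hv2 := congrFun hv 1
  simp only [Matrix.mulVec, dotProduct, Fin.sum_univ_two, Matrix.of_apply, Matrix.cons_val',
    Matrix.cons_val_zero, Matrix.cons_val_one, Matrix.cons_val_fin_one, Pi.zero_apply] at hv1 hv2
  set y : ℝ → ℂ := fun x => solC q a x z * v 0 + solS a x z * v 1 with hy
  set dy : ℝ → ℂ := fun x => derivSolC q a x z * v 0 + Complex.cos (rho z * (x - a : ℝ)) * v 1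
    with hdy
  have hya : y a = v 0 := by simp [hy, solC_self, solS]
  have hScont : Continuous fun x => solS a x z :=
    (continuous_sinDiv z).comp (continuous_sub_right a)
  have hycont : ContinuousOn y (Set.Icc 0 Real.pi) :=
    ((continuousOn_solC hq ha' z).mul continuousOn_const).add
      (hScont.mul continuous_const).continuousOn
  have hccont : Continuous fun x : ℝ => Complex.cos (rho z * (x - a : ℝ)) :=
    (continuous_cos_rho z).comp (continuous_sub_right a)
  refine ⟨y, dy, fun x => q x * y a - z * y x, ⟨?_, ?_, ?_⟩, ?_, hv1, hv2, ?_⟩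
  · refine (hq.mul_const _).sub (MemLp.const_mul ?_ z)
    obtain ⟨B, hB⟩ := isCompact_Icc.exists_bound_of_continuousOn hycont
    refine MemLp.of_bound
      ((hycont.mono Set.Ioo_subset_Icc_self).aestronglyMeasurable measurableSet_Ioo) B ?_
    filter_upwards [ae_restrict_mem measurableSet_Ioo] with x hx
    exact hB x (Set.Ioo_subset_Icc_self hx)
  · apply eq_add_integral_zero
    · intro x hx
      exact ((intervalIntegrable_of_continuousOn (continuousOn_derivSolC hq ha' z) ha' hx).mul_const
        _).add ((hccont.intervalIntegrable a x).mul_const _)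
    · intro x hx
      rw [hya]
      simp only [hy, hdy]
      rw [intervalIntegral.integral_add
        ((intervalIntegrable_of_continuousOn (continuousOn_derivSolC hq ha' z) ha' hx).mul_const _)
        ((hccont.intervalIntegrable a x).mul_const _), intervalIntegral.integral_mul_const,
        intervalIntegral.integral_mul_const, integral_cos_rho_sub, solC_eq_integral hq ha' z hx,
        solC_self, solS]
      ring
  · apply eq_add_integral_zero
    · intro x hx
      exact ((intervalIntegrable_of_memLp hq ha' hx).mul_const _).sub
        ((intervalIntegrable_of_continuousOn hycont ha' hx).const_mul z)
    · intro x hx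
      have hC := intervalIntegrable_of_continuousOn (continuousOn_solC hq ha' z) ha' hx
      have hi := intervalIntegrable_of_memLp hq ha' hx
      have hs : Continuous fun u : ℝ => -(z * sinDiv z (u - a)) := (hScont.const_mul z).neg
      have hsplit : (fun u => q u * y a - z * y u) =
          fun u => (q u - z * solC q a u z) * v 0 + -(z * sinDiv z (u - a)) * v 1 := by
        funext u
        rw [hya]
        simp only [hy, solS]
        ring
      rw [hsplit, intervalIntegral.integral_add ((hi.sub (hC.const_mul z)).mul_const _)
        ((hs.intervalIntegrable a x).mul_const _),
        intervalIntegral.integral_mul_const, intervalIntegral.integral_mul_const,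
        integral_sinDiv_sub]
      simp only [hdy]
      rw [derivSolC_eq_integral hq ha' z hx, derivSolC_self]
      simp
      ring
  · exact Eventually.of_forall fun x => by ring
  -- If `y` vanished identically, its value `v 0` and its derivative `v 1` at the interior point `a`
  -- would both be zero.
  · by_contra hcon
    push Not at hcon
    have hv00 : v 0 = 0 := by rw [← hya]; exact hcon a ha'
    have hd : HasDerivAt (fun x => solS a x z * v 1) (Complex.cos (rho z * (a - a : ℝ)) * v 1) a :=
      ((hasDerivAt_sinDiv z (a - a)).comp_sub_const a a).mul_const _
    have hev : (fun x => solS a x z * v 1) =ᶠ[𝓝 a] fun _ => 0 := by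
      filter_upwards [Icc_mem_nhds ha.1 ha.2] with x hx
      have := hcon x hx
      simpa [hy, hv00] using this
    have h0 := hd.unique ((hasDerivAt_const a (0 : ℂ)).congr_of_eventuallyEq hev)
    have hv10 : v 1 = 0 := by simpa using h0
    apply hv0
    ext i
    fin_cases i
    · exact hv00
    · exact hv10

/-- Off the spectrum `Δ` does not vanish, so its order there is 0, the default value of the
multiplicity. -/
theorem eigMultiplicity_eq (hq : MemLp q 2 (volume.restrict (Set.Ioo 0 Real.pi)))
    (ha : a ∈ Set.Ioo 0 Real.pi) (z : ℂ) :
    eigMultiplicity q a z = analyticOrderAt (charDelta q a) z := by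
  rw [eigMultiplicity]
  split_ifs with h
  · rfl
  · symm
    rw [analyticOrderAt_eq_zero]
    exact Or.inr fun h0 => h (isEigenvalue_of_charDelta_eq_zero hq ha h0)

end Solutions

end FrozenArgument

/-! ### Lower bounds for the complex cosine -/

namespace FrozenArgument

theorem abs_cos_re_le_norm_cos (u : ℂ) : |Real.cos u.re| ≤ ‖Complex.cos u‖ := by
  have h : (Complex.cos u).re = Real.cos u.re * Real.cosh u.im := by
    rw [Complex.cos_eq]
    simp [← Complex.ofReal_cos, ← Complex.ofReal_sin, ← Complex.ofReal_cosh, ← Complex.ofReal_sinh]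
  have h1 := Complex.abs_re_le_norm (Complex.cos u)
  rw [h, abs_mul] at h1
  have h2 : 1 ≤ |Real.cosh u.im| := (Real.one_le_cosh _).trans (le_abs_self _)
  exact (le_mul_of_one_le_right (abs_nonneg _) h2).trans h1

/-- Indeed `|cos (x + i y)| ^ 2 = cos² x + sinh² y`. -/
theorem sinh_abs_im_le_norm_cos (u : ℂ) : Real.sinh |u.im| ≤ ‖Complex.cos u‖ := by
  have hre : (Complex.cos u).re = Real.cos u.re * Real.cosh u.im := by
    rw [Complex.cos_eq]
    simp [← Complex.ofReal_cos, ← Complex.ofReal_sin, ← Complex.ofReal_cosh, ← Complex.ofReal_sinh]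
  have him : (Complex.cos u).im = -(Real.sin u.re * Real.sinh u.im) := by
    rw [Complex.cos_eq]
    simp [← Complex.ofReal_cos, ← Complex.ofReal_sin, ← Complex.ofReal_cosh, ← Complex.ofReal_sinh]
  rw [← Real.abs_sinh]
  apply abs_le_of_sq_le_sq _ (norm_nonneg _)
  rw [← Complex.normSq_eq_norm_sq, Complex.normSq_apply, hre, him]
  nlinarith [Real.cosh_sq u.im, Real.sin_sq_add_cos_sq u.re, sq_nonneg (Real.cos u.re)]

theorem exists_odd_abs_sub_le_abs_cos (x : ℝ) :
    ∃ m : ℤ, Odd m ∧ |x - m| ≤ |Real.cos (x * (Real.pi / 2))| := by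
  -- An odd integer at distance at most 1; the estimate is then Jordan's inequality for the sine on
  -- `[-π/2, π/2]`.
  refine ⟨2 * ⌊x / 2⌋ + 1, ⟨_, rfl⟩, ?_⟩
  set k := ⌊x / 2⌋ with hk
  have h1 : (k : ℝ) ≤ x / 2 := Int.floor_le _
  have h2 : x / 2 < k + 1 := Int.lt_floor_add_one _
  push_cast
  set d : ℝ := x - (2 * k + 1) with hd
  have hd1 : |d| ≤ 1 := abs_le.2 ⟨by linarith, by linarith⟩
  have hx : x * (Real.pi / 2) = (d * (Real.pi / 2) + Real.pi / 2) + k * Real.pi := by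
    rw [hd]; ring
  rw [hx, Real.cos_add_int_mul_pi, Real.cos_add_pi_div_two, abs_mul, abs_neg]
  have h3 : |((-1 : ℝ) ^ k)| = 1 := by
    rw [abs_zpow]; simp
  rw [h3, one_mul]
  have hpi := Real.pi_pos
  have h4 : |d * (Real.pi / 2)| ≤ Real.pi / 2 := by
    rw [abs_mul, abs_of_pos (by positivity : 0 < Real.pi / 2)]
    exact mul_le_of_le_one_left (by positivity) hd1
  have h5 := Real.mul_abs_le_abs_sin h4
  rw [abs_mul, abs_of_pos (by positivity : 0 < Real.pi / 2)] at h5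
  refine le_trans (le_of_eq ?_) h5
  field_simp

/-- Where `cos (π w / 2)` is small compared to `exp (π |Im w| / 2)`, `w` is near an odd integer. -/
theorem exists_odd_norm_sub_le {B : ℝ} {w : ℂ} (hw0 : 0 < ‖w‖)
    (hw : 4 * B ≤ ‖w‖)
    (h : ‖Complex.cos (w * (Real.pi / 2 : ℝ))‖ ≤ B * Real.exp (|w.im| * (Real.pi / 2)) / ‖w‖) :
    ∃ m : ℤ, Odd m ∧ ‖w - m‖ ≤ 4 * B / ‖w‖ := by
  have hpi := Real.pi_gt_three
  set Y := |w.im| * (Real.pi / 2) with hY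
  have hY0 : 0 ≤ Y := by positivity
  have hre : (w * (Real.pi / 2 : ℝ)).re = w.re * (Real.pi / 2) := Complex.re_mul_ofReal _ _
  have him : |(w * (Real.pi / 2 : ℝ)).im| = Y := by
    rw [Complex.im_mul_ofReal, abs_mul, abs_of_pos (by positivity : 0 < Real.pi / 2)]
  have hsinh := sinh_abs_im_le_norm_cos (w * (Real.pi / 2 : ℝ))
  have hcos := abs_cos_re_le_norm_cos (w * (Real.pi / 2 : ℝ))
  rw [him] at hsinh
  rw [hre] at hcos
  set N := ‖Complex.cos (w * (Real.pi / 2 : ℝ))‖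
  have hE0 : 0 < Real.exp Y := Real.exp_pos _
  -- As `B ≤ ‖w‖ / 4`, the hypothesis gives `sinh Y ≤ exp Y / 4`, which bounds `Y`; the exponential
  -- then costs only a factor 2.
  have hE : Real.exp Y ≤ 2 := by
    have h1 : B * Real.exp Y / ‖w‖ ≤ Real.exp Y / 4 := by
      rw [div_le_div_iff₀ hw0 (by norm_num)]
      nlinarith
    have h2 : Real.sinh Y ≤ Real.exp Y / 4 := hsinh.trans (h.trans h1)
    rw [Real.sinh_eq, Real.exp_neg] at h2
    have h3 : Real.exp Y * (Real.exp Y)⁻¹ = 1 := mul_inv_cancel₀ hE0.ne'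
    nlinarith
  have hB : 0 ≤ B := by
    have h1 : 0 ≤ B * Real.exp Y / ‖w‖ := (norm_nonneg _).trans h
    rw [mul_div_right_comm] at h1
    have h2 := nonneg_of_mul_nonneg_left h1 hE0
    by_contra hcon
    exact absurd (div_neg_of_neg_of_pos (not_le.1 hcon) hw0) (not_lt.2 h2)
  have hN : N ≤ 2 * B / ‖w‖ := by
    refine h.trans (div_le_div_of_nonneg_right ?_ hw0.le)
    nlinarith
  obtain ⟨m, hm, hxm⟩ := exists_odd_abs_sub_le_abs_cos w.re
  refine ⟨m, hm, ?_⟩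
  have h1 : ‖w - m‖ ≤ |w.re - m| + |w.im| := by
    simpa using Complex.norm_le_abs_re_add_abs_im (w - m)
  have h2 : |w.im| ≤ Y := le_mul_of_one_le_right (abs_nonneg _) (by linarith)
  have h3 : Y ≤ Real.sinh Y := Real.self_le_sinh_iff.2 hY0
  have h4 : 4 * B / ‖w‖ = 2 * B / ‖w‖ + 2 * B / ‖w‖ := by ring
  linarith

end FrozenArgument

/-! ### Square summability of the sine coefficients -/

namespace FrozenArgument

open MeasureTheory

/-- Bessel's inequality for the sine coefficients of a square integrable function. -/
theorem summable_norm_sineTransform_sq {p : ℝ → ℂ} {a : ℝ} (ha : 0 ≤ a) (ha' : a ≤ 2 * Real.pi)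
    (hp : MemLp p 2 (volume.restrict (Set.Ioc 0 a))) :
    Summable fun n : ℕ => ‖sineTransform p a n‖ ^ 2 := by
  have hpi := Real.pi_pos
  have h2pi : (0 : ℝ) < 2 * Real.pi := by positivity
  -- Extension by zero to a full period makes the exponentials `exp (i n t)` orthogonal; sine
  -- coefficients are then differences of Fourier coefficients at `±n`.
  set f : ℝ → ℂ := (Set.Ioc 0 a).indicator p with hf
  have hsub : Set.Ioc 0 a ⊆ Set.Ioc 0 (2 * Real.pi) := Set.Ioc_subset_Ioc_right ha'
  have hfL : MemLp f 2 (volume.restrict (Set.Ioc 0 (2 * Real.pi))) := by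
    rw [hf, memLp_indicator_iff_restrict measurableSet_Ioc,
      Measure.restrict_restrict measurableSet_Ioc, Set.inter_eq_left.2 hsub]
    exact hp
  have hsum := (hasSum_sq_fourierCoeffOn h2pi hfL).summable
  have hpint : IntervalIntegrable p volume 0 a := by
    rw [intervalIntegrable_iff_integrableOn_Ioc_of_le ha]
    exact hp.integrable (by norm_num)
  have hcoef : ∀ n : ℤ, fourierCoeffOn h2pi f n =
      (1 / (2 * Real.pi) : ℂ) * ∫ t in (0 : ℝ)..a, p t * Complex.exp (-(n * t * Complex.I)) := by
    intro n
    rw [fourierCoeffOn_eq_integral, sub_zero]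
    have hpt : (fun x : ℝ => fourier (-n) (x : AddCircle (2 * Real.pi)) • f x) =
        (Set.Ioc 0 a).indicator fun x => p x * Complex.exp (-(n * x * Complex.I)) := by
      funext x
      rw [hf, fourier_coe_apply]
      by_cases hx : x ∈ Set.Ioc 0 a
      · rw [Set.indicator_of_mem hx, Set.indicator_of_mem hx, smul_eq_mul, mul_comm]
        congr 2
        push_cast
        have : (Real.pi : ℂ) ≠ 0 := by exact_mod_cast hpi.ne'
        field_simp
      · rw [Set.indicator_of_notMem hx, Set.indicator_of_notMem hx, smul_zero]
    rw [hpt, intervalIntegral.integral_of_le h2pi.le, integral_indicator measurableSet_Ioc,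
      Measure.restrict_restrict measurableSet_Ioc, Set.inter_eq_left.2 hsub,
      intervalIntegral.integral_of_le ha, Complex.real_smul]
    push_cast
    rfl
  have hsin : ∀ n : ℕ, sineTransform p a n = (Real.pi * Complex.I) *
      (fourierCoeffOn h2pi f n - fourierCoeffOn h2pi f (-n)) := by
    intro n
    rw [hcoef, hcoef, ← mul_sub, ← intervalIntegral.integral_sub
      (hpint.mul_continuousOn (by fun_prop)) (hpint.mul_continuousOn (by fun_prop)),
      sineTransform, ← mul_assoc, ← intervalIntegral.integral_const_mul]
    congr 1
    funext t
    have : (Real.pi : ℂ) ≠ 0 := by exact_mod_cast hpi.ne'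
    rw [Complex.sin]
    push_cast
    simp only [neg_mul, neg_neg]
    field_simp
  have h1 : Summable fun n : ℕ => ‖fourierCoeffOn h2pi f n‖ ^ 2 :=
    hsum.comp_injective (i := fun n : ℕ => (n : ℤ)) Nat.cast_injective
  have h2 : Summable fun n : ℕ => ‖fourierCoeffOn h2pi f (-n)‖ ^ 2 :=
    hsum.comp_injective (i := fun n : ℕ => -(n : ℤ)) (neg_injective.comp Nat.cast_injective)
  refine Summable.of_nonneg_of_le (fun n => by positivity) (fun n => ?_)
    ((h1.add h2).mul_left (Real.pi ^ 2 * 2))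
  rw [hsin, norm_mul, norm_mul, Complex.norm_I, mul_one, Complex.norm_real, Real.norm_eq_abs,
    abs_of_pos hpi, mul_pow, mul_assoc]
  refine mul_le_mul_of_nonneg_left ?_ (by positivity)
  have h3 := norm_sub_le (fourierCoeffOn h2pi f n) (fourierCoeffOn h2pi f (-n))
  have h4 := pow_le_pow_left₀ (norm_nonneg _) h3 2
  nlinarith [sq_nonneg (‖fourierCoeffOn h2pi f n‖ - ‖fourierCoeffOn h2pi f (-n)‖)]

theorem memLp_symm {q : ℝ → ℂ} (hq : MemLp q 2 (volume.restrict (Set.Ioo 0 Real.pi))) :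
    MemLp (fun t => q t + q (Real.pi - t)) 2 (volume.restrict (Set.Ioc 0 (Real.pi / 2))) := by
  have hpi := Real.pi_pos
  have hmp := (Measure.measurePreserving_sub_left (volume : Measure ℝ) Real.pi).restrict_preimage
    (measurableSet_Ioo (a := 0) (b := Real.pi))
  have hpre : (fun t : ℝ => Real.pi - t) ⁻¹' Set.Ioo 0 Real.pi = Set.Ioo 0 Real.pi := by simp
  rw [hpre] at hmp
  refine (hq.add (hq.comp_measurePreserving hmp)).mono_measure (Measure.restrict_mono ?_ le_rfl)
  exact fun t ht => ⟨ht.1, by linarith [ht.2]⟩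

end FrozenArgument

/-! ### Zeros of the unperturbed characteristic function -/

namespace FrozenArgument

open MeasureTheory Filter Topology Metric

theorem sinDiv_pi_eq_zero_iff {z : ℂ} :
    sinDiv z Real.pi = 0 ↔ ∃ n : ℕ, 1 ≤ n ∧ z = (n : ℂ) ^ 2 := by
  have hpi : (Real.pi : ℂ) ≠ 0 := by exact_mod_cast Real.pi_ne_zero
  constructor
  · intro h
    have hz : z ≠ 0 := by
      rintro rfl
      simp [sinDiv, Real.pi_ne_zero] at h
    have h1 := rho_mul_sinDiv z Real.pi
    rw [h, mul_zero] at h1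
    obtain ⟨k, hk⟩ := Complex.sin_eq_zero_iff.1 h1.symm
    have hk' : rho z = k := mul_right_cancel₀ hpi hk
    refine ⟨k.natAbs, ?_, ?_⟩
    · rw [Nat.one_le_iff_ne_zero, Int.natAbs_ne_zero]
      rintro rfl
      exact hz (rho_eq_zero_iff.1 (by simpa using hk'))
    · rw [← rho_sq z, hk']
      have : ((k.natAbs : ℤ) : ℂ) ^ 2 = (k : ℂ) ^ 2 := by
        exact_mod_cast Int.natAbs_sq k
      simpa using this.symm
  · rintro ⟨n, hn, rfl⟩
    have hn0 : (n : ℂ) ≠ 0 := by exact_mod_cast (by omega : n ≠ 0)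
    have hr : rho ((n : ℂ) ^ 2) ≠ 0 := mt rho_eq_zero_iff.1 (pow_ne_zero 2 hn0)
    have h1 := rho_mul_sinDiv ((n : ℂ) ^ 2) Real.pi
    have h2 : Complex.sin (rho ((n : ℂ) ^ 2) * Real.pi) = 0 := by
      rcases rho_eq_or_eq_neg (rfl : (n : ℂ) ^ 2 = (n : ℂ) ^ 2) with h | h <;>
        simp [h, neg_mul, Complex.sin_nat_mul_pi]
    rw [h2] at h1
    exact (mul_eq_zero.1 h1).resolve_left hr

/-- Differentiate `ρ sinDiv = sin (ρ π)` in `z`: at a multiple zero the left side vanishes, while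
`cos (ρ π)` and `ρ'` are nonzero (the latter since `2 ρ ρ' = 1`). -/
theorem analyticOrderAt_sinDiv_pi {n : ℕ} (hn : 1 ≤ n) :
    analyticOrderAt (fun z => sinDiv z Real.pi) ((n : ℂ) ^ 2) = 1 := by
  have hn0 : (0 : ℝ) < n := by exact_mod_cast hn
  have hd := differentiable_sinDiv Real.pi
  have hz0 : sinDiv ((n : ℂ) ^ 2) Real.pi = 0 := sinDiv_pi_eq_zero_iff.2 ⟨n, hn, rfl⟩
  have hpi : (Real.pi : ℂ) ≠ 0 := by exact_mod_cast Real.pi_ne_zero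
  apply AnalyticAt.analyticOrderAt_eq_one_of_zero_deriv_ne_zero (hd.analyticAt _) hz0
  intro hder
  have hrd : DifferentiableAt ℂ rho ((n : ℂ) ^ 2) := by
    unfold rho
    refine DifferentiableAt.cpow_const differentiableAt_fun_id ?_
    left
    have : ((n : ℂ) ^ 2) = (((n : ℝ) ^ 2 : ℝ) : ℂ) := by push_cast; rfl
    rw [this, Complex.ofReal_re]
    positivity
  have hr := hrd.hasDerivAt
  set r' := deriv rho ((n : ℂ) ^ 2)
  have h1 : r' * 1 ≠ 0 := by
    have h2 := hr.mul hr
    have h3 : (rho * rho) = fun z => z := by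
      funext z
      simpa [sq] using rho_sq z
    rw [h3] at h2
    have := h2.unique (hasDerivAt_id' _)
    intro h
    simp only [mul_one] at h
    simp [h] at this
  have hprod := hr.mul (hd ((n : ℂ) ^ 2)).hasDerivAt
  have hfun : (rho * fun z => sinDiv z Real.pi) = fun z => Complex.sin (rho z * Real.pi) := by
    funext z
    exact rho_mul_sinDiv z Real.pi
  rw [hfun, hder, hz0] at hprod
  have h4 := hprod.unique (hr.mul_const (Real.pi : ℂ)).csin
  have h5 : Complex.sin (rho ((n : ℂ) ^ 2) * Real.pi) = 0 := by
    rw [← rho_mul_sinDiv, hz0, mul_zero]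
  have h6 := Complex.sin_sq_add_cos_sq (rho ((n : ℂ) ^ 2) * Real.pi)
  rw [h5] at h6
  have h7 : Complex.cos (rho ((n : ℂ) ^ 2) * Real.pi) ≠ 0 := by
    intro h
    simp [h] at h6
  simp only [mul_zero, add_zero] at h4
  rw [mul_one] at h1
  exact mul_ne_zero h7 (mul_ne_zero h1 hpi) h4.symm

theorem analyticOrderAt_ne_top_of_entire {f : ℂ → ℂ} (hf : Differentiable ℂ f) {z₀ : ℂ}
    (h : f z₀ ≠ 0) (z : ℂ) : analyticOrderAt f z ≠ ⊤ := by
  intro htop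
  have hf' : AnalyticOnNhd ℂ f Set.univ := fun z _ => hf.analyticAt z
  exact h (hf'.eqOn_zero_of_preconnected_of_eventuallyEq_zero isPreconnected_univ
    (Set.mem_univ z) (analyticOrderAt_eq_top.1 htop) (Set.mem_univ _))

theorem finite_zeros_ball {f : ℂ → ℂ} (hf : Differentiable ℂ f) {z₀ : ℂ}
    (h : f z₀ ≠ 0) (c : ℂ) (R : ℝ) : {z | z ∈ ball c R ∧ f z = 0}.Finite := by
  by_contra hinf
  obtain ⟨x, -, hx⟩ := Set.Infinite.exists_accPt_of_subset_isCompact hinf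
    (isCompact_closedBall c R) fun z hz => ball_subset_closedBall hz.1
  have hfr : ∃ᶠ z in 𝓝[≠] x, f z = 0 := by
    rw [accPt_iff_frequently_nhdsNE] at hx
    exact hx.mono fun z hz => hz.2
  have hf' : AnalyticOnNhd ℂ f Set.univ := fun z _ => hf.analyticAt z
  exact h (hf'.eqOn_zero_of_preconnected_of_frequently_eq_zero isPreconnected_univ
    (Set.mem_univ x) hfr (Set.mem_univ _))

/-! ### Counting eigenvalues and locating the n-th one -/

section Counting

variable {q : ℝ → ℂ}

theorem half_pi_mem_Ioo : Real.pi / 2 ∈ Set.Ioo 0 Real.pi :=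
  ⟨by linarith [Real.pi_pos], by linarith [Real.pi_pos]⟩

theorem charDelta_eq_add (hq : MemLp q 2 (volume.restrict (Set.Ioo 0 Real.pi))) (z : ℂ) :
    charDelta q (Real.pi / 2) z = sinDiv z Real.pi + sinDiv z (Real.pi / 2) *
        ∫ t in (0 : ℝ)..(Real.pi / 2), (q t + q (Real.pi - t)) * sinDiv z t := by
  rw [charDelta_eq hq, mul_add, ← sinDiv_add_self, add_halves]

theorem rho_mul_integral_mul_sinDiv (p : ℝ → ℂ) (a : ℝ) (z : ℂ) :
    rho z * ∫ t in (0 : ℝ)..a, p t * sinDiv z t = sineTransform p a (rho z) := by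
  rw [← intervalIntegral.integral_const_mul, sineTransform]
  congr 1
  funext t
  rw [← rho_mul_sinDiv]
  ring

/-- If the perturbation dominates `2 cos (π ρ / 2)`, then `ρ` is near an odd integer. -/
theorem exists_odd_norm_rho_sub_le (hq : MemLp q 2 (volume.restrict (Set.Ioo 0 Real.pi))) :
    ∃ M : ℝ, 0 ≤ M ∧ ∀ z : ℂ, 4 * M ≤ ‖rho z‖ → 0 < ‖rho z‖ →
      ‖2 * Complex.cos (rho z * (Real.pi / 2 : ℝ))‖ ≤
        ‖∫ t in (0 : ℝ)..(Real.pi / 2), (q t + q (Real.pi - t)) * sinDiv z t‖ →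
      ∃ m : ℤ, Odd m ∧ ‖rho z - m‖ ≤ 4 * M / ‖rho z‖ := by
  have ha : (0 : ℝ) ≤ Real.pi / 2 := by positivity
  set p : ℝ → ℂ := fun t => q t + q (Real.pi - t) with hp
  have hpi : IntervalIntegrable p volume 0 (Real.pi / 2) := intervalIntegrable_symm hq
  refine ⟨∫ t in (0 : ℝ)..(Real.pi / 2), ‖p t‖,
    intervalIntegral.integral_nonneg ha fun t _ => norm_nonneg _, fun z hz hz0 h => ?_⟩
  refine exists_odd_norm_sub_le hz0 hz ?_
  have h1 := norm_sineTransform_le ha hpi (rho z)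
  rw [← rho_mul_integral_mul_sinDiv, norm_mul] at h1
  rw [le_div_iff₀ hz0, mul_comm]
  refine le_trans ?_ h1
  refine mul_le_mul_of_nonneg_left (le_trans ?_ h) hz0.le
  rw [norm_mul, Complex.norm_ofNat]
  linarith [norm_nonneg (Complex.cos (rho z * (Real.pi / 2 : ℝ)))]

/-- After cancelling `sinDiv z (π / 2)`, failure of the inequality would put `ρ` within `4 M / ‖ρ‖ <
1/2` of an integer, impossible when `‖ρ‖ = N + 1/2`. The threshold `8 * M` comes from this. -/
theorem eventually_norm_charDelta_sub_lt
    (hq : MemLp q 2 (volume.restrict (Set.Ioo 0 Real.pi))) :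
    ∀ᶠ N : ℕ in atTop, ∀ z : ℂ, ‖z‖ = ((N : ℝ) + 1 / 2) ^ 2 →
      ‖charDelta q (Real.pi / 2) z - sinDiv z Real.pi‖ < ‖sinDiv z Real.pi‖ := by
  obtain ⟨M, hM0, hM⟩ := exists_odd_norm_rho_sub_le hq
  filter_upwards [eventually_ge_atTop (⌈8 * M⌉₊)] with N hN z hz
  have hN' : 8 * M ≤ N := Nat.ceil_le.1 hN
  have hr : ‖rho z‖ = (N : ℝ) + 1 / 2 := by
    have h1 := norm_rho_sq z
    rw [hz] at h1
    exact (pow_left_inj₀ (norm_nonneg _) (by positivity) two_ne_zero).1 h1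
  have hr0 : 0 < ‖rho z‖ := by rw [hr]; positivity
  have hnear : ∀ m : ℤ, ¬ ‖rho z - m‖ < 1 / 2 := by
    intro m hm
    have h1 := abs_norm_sub_norm_le (rho z) m
    have h2 : ‖(m : ℂ)‖ = ((|m| : ℤ) : ℝ) := by
      rw [Complex.norm_intCast]; push_cast; rfl
    rw [hr, h2] at h1
    have h3 := abs_lt.1 (h1.trans_lt hm)
    have h4 : ((|m| : ℤ) : ℝ) < ((N + 1 : ℤ) : ℝ) := by push_cast at *; linarith [h3.1]
    have h5 : ((N : ℤ) : ℝ) < ((|m| : ℤ) : ℝ) := by push_cast at *; linarith [h3.2]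
    have h6 := Int.cast_lt.1 h4
    have h7 := Int.cast_lt.1 h5
    omega
  have hs0 : sinDiv z Real.pi ≠ 0 := by
    intro h
    obtain ⟨n, -, hn⟩ := sinDiv_pi_eq_zero_iff.1 h
    rcases rho_eq_or_eq_neg hn.symm with h | h
    · exact hnear n (by simp [h])
    · exact hnear (-n) (by simp [h])
  have hfac : sinDiv z Real.pi = sinDiv z (Real.pi / 2) *
      (2 * Complex.cos (rho z * (Real.pi / 2 : ℝ))) := by
    rw [← sinDiv_add_self, add_halves]
  rw [hfac] at hs0
  rw [charDelta_eq_add hq, add_sub_cancel_left, hfac, norm_mul, norm_mul]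
  refine mul_lt_mul_of_pos_left ?_ (norm_pos_iff.2 (left_ne_zero_of_mul hs0))
  by_contra hcon
  obtain ⟨m, -, hm⟩ := hM z (by rw [hr]; linarith) hr0 (not_lt.1 hcon)
  refine hnear m (hm.trans_lt ?_)
  rw [div_lt_iff₀ hr0, hr]
  linarith

/-- For large `N` exactly `N` eigenvalues have modulus less than `(N + 1 / 2) ^ 2`. -/
theorem eventually_encard_eq (hq : MemLp q 2 (volume.restrict (Set.Ioo 0 Real.pi)))
    {lam : ℕ → ℂ} (hlam : IsSpectrumNumbering q (Real.pi / 2) lam) :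
    ∀ᶠ N : ℕ in atTop, {n : ℕ | 1 ≤ n ∧ ‖lam n‖ < ((N : ℝ) + 1 / 2) ^ 2}.encard = N := by
  filter_upwards [eventually_norm_charDelta_sub_lt hq] with N hN
  set R : ℝ := ((N : ℝ) + 1 / 2) ^ 2 with hR
  have hR0 : 0 < R := by positivity
  set Δ := charDelta q (Real.pi / 2) with hΔ
  have hd : Differentiable ℂ Δ := differentiable_charDelta hq
  have hpt : ‖(R : ℂ)‖ = R := by rw [Complex.norm_real, Real.norm_eq_abs, abs_of_pos hR0]
  have hΔ0 : Δ R ≠ 0 := by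
    intro h
    have := hN R hpt
    rw [h, zero_sub, norm_neg] at this
    exact lt_irrefl _ this
  have hfin := finite_zeros_ball hd hΔ0 0 R
  have hcount : ∀ z, {n : ℕ | 1 ≤ n ∧ lam n = z}.encard = analyticOrderNatAt Δ z := by
    intro z
    rw [hlam.count, eigMultiplicity_eq hq half_pi_mem_Ioo,
      Nat.cast_analyticOrderNatAt (analyticOrderAt_ne_top_of_entire hd hΔ0 z)]
  set Zg : Finset ℂ := (Finset.Icc 1 N).image fun n : ℕ => (n : ℂ) ^ 2 with hZg
  have hinj : Function.Injective fun n : ℕ => (n : ℂ) ^ 2 := by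
    intro m n hmn
    have : m ^ 2 = n ^ 2 := by
      have h : (m : ℂ) ^ 2 = (n : ℂ) ^ 2 := hmn
      exact_mod_cast h
    exact (Nat.pow_left_injective (n := 2) two_ne_zero) this
  have hrouche := sum_order_eq_of_norm_sub_lt hR0 0 hd (differentiable_sinDiv Real.pi)
    (fun z hz => hN z (by simpa using hz)) (Zf := hfin.toFinset) (Zg := Zg) (fun z => by simp)
    (by
      intro z
      rw [sinDiv_pi_eq_zero_iff, hZg, Finset.mem_image]
      have hlt : ∀ n : ℕ, (n : ℂ) ^ 2 ∈ ball (0 : ℂ) R ↔ n ≤ N := by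
        intro n
        rw [mem_ball_zero_iff, norm_pow, Complex.norm_natCast, hR,
          pow_lt_pow_iff_left₀ (by positivity) (by positivity) two_ne_zero]
        constructor
        · intro h
          have : (n : ℝ) < (N + 1 : ℕ) := by push_cast; linarith
          exact Nat.lt_succ_iff.1 (Nat.cast_lt.1 this)
        · intro h
          have : (n : ℝ) ≤ N := Nat.cast_le.2 h
          linarith
      constructor
      · rintro ⟨n, hn, rfl⟩
        rw [Finset.mem_Icc] at hn
        exact ⟨(hlt n).2 hn.2, n, hn.1, rfl⟩
      · rintro ⟨hz, n, hn, rfl⟩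
        exact ⟨n, Finset.mem_Icc.2 ⟨hn, (hlt n).1 hz⟩, rfl⟩)
  have hsum : ∑ a ∈ Zg, analyticOrderNatAt (fun z => sinDiv z Real.pi) a = N := by
    rw [hZg, Finset.sum_image hinj.injOn, Finset.sum_congr rfl (g := fun _ => 1)]
    · simp
    · intro n hn
      rw [analyticOrderNatAt, analyticOrderAt_sinDiv_pi (Finset.mem_Icc.1 hn).1]
      rfl
  rw [hsum] at hrouche
  have hfib : ∀ z, {n : ℕ | 1 ≤ n ∧ lam n = z}.Finite := fun z =>
    Set.finite_of_encard_eq_coe (hcount z)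
  have hzero : ∀ n, 1 ≤ n → Δ (lam n) = 0 := by
    intro n hn
    have h1 := hcount (lam n)
    apply apply_eq_zero_of_analyticOrderNatAt_ne_zero (𝕜 := ℂ)
    intro h0
    rw [h0, Nat.cast_zero, Set.encard_eq_zero] at h1
    exact (Set.eq_empty_iff_forall_notMem.1 h1 n) ⟨hn, rfl⟩
  set A : Set ℕ := {n : ℕ | 1 ≤ n ∧ ‖lam n‖ < R} with hA
  have hAfin : A.Finite := by
    refine (hfin.biUnion fun z _ => hfib z).subset fun n hn => ?_
    simp only [Set.mem_iUnion]
    exact ⟨lam n, ⟨by simpa using hn.2, hzero n hn.1⟩, hn.1, rfl⟩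
  -- Indices are grouped by the value of `lam`; each fibre has as many elements as the order of the
  -- zero.
  have hcard : hAfin.toFinset.card = ∑ z ∈ hfin.toFinset, analyticOrderNatAt Δ z := by
    rw [Finset.card_eq_sum_card_fiberwise (f := lam) (t := hfin.toFinset)]
    · refine Finset.sum_congr rfl fun z hz => ?_
      have h1 := hcount z
      have h2 : {n : ℕ | 1 ≤ n ∧ lam n = z} =
          ((hAfin.toFinset.filter fun n => lam n = z : Finset ℕ) : Set ℕ) := by
        ext n
        simp only [Set.mem_ofPred_eq, Finset.coe_filter, Set.Finite.mem_toFinset, hA]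
        have hz' : ‖z‖ < R := by simpa using ((Set.Finite.mem_toFinset _).1 hz).1
        constructor
        · rintro ⟨h, rfl⟩
          exact ⟨⟨h, hz'⟩, rfl⟩
        · rintro ⟨⟨h, -⟩, rfl⟩
          exact ⟨h, rfl⟩
      rw [h2, Set.encard_coe_eq_coe_finsetCard] at h1
      exact_mod_cast h1
    · intro n hn
      have hn' : n ∈ A := by simpa using hn
      simpa using ⟨hn'.2, hzero n hn'.1⟩
  rw [hAfin.encard_eq_coe_toFinset_card, hcard, hrouche]

theorem charDelta_eq_zero_of_isSpectrumNumbering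
    (hq : MemLp q 2 (volume.restrict (Set.Ioo 0 Real.pi)))
    {lam : ℕ → ℂ} (hlam : IsSpectrumNumbering q (Real.pi / 2) lam) {n : ℕ} (hn : 1 ≤ n) :
    charDelta q (Real.pi / 2) (lam n) = 0 := by
  have h1 := hlam.count (lam n)
  rw [eigMultiplicity_eq hq half_pi_mem_Ioo] at h1
  apply apply_eq_zero_of_analyticOrderAt_ne_zero (𝕜 := ℂ)
  rw [← h1, Ne, Set.encard_eq_zero]
  exact fun h0 => (Set.eq_empty_iff_forall_notMem.1 h0 n) ⟨hn, rfl⟩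

/-- For large `N` the indices with modulus below `(N + 1/2) ^ 2` form an initial segment with `N`
elements, hence are exactly `1, …, N`. -/
theorem eventually_norm_mem_annulus (hq : MemLp q 2 (volume.restrict (Set.Ioo 0 Real.pi)))
    {lam : ℕ → ℂ} (hlam : IsSpectrumNumbering q (Real.pi / 2) lam) :
    ∀ᶠ n : ℕ in atTop, ((n : ℝ) - 1 / 2) ^ 2 ≤ ‖lam n‖ ∧ ‖lam n‖ < ((n : ℝ) + 1 / 2) ^ 2 := by
  obtain ⟨M₀, hM₀⟩ := eventually_atTop.1 hlam.eventually_monotone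
  have hmono : ∀ j k, M₀ ≤ j → j ≤ k → ‖lam j‖ ≤ ‖lam k‖ := by
    intro j k hj hjk
    induction k, hjk using Nat.le_induction with
    | base => exact le_rfl
    | succ k hk ih => exact ih.trans (hM₀ k (hj.trans hk))
  -- Bounds the finitely many moduli before monotonicity sets in; larger discs contain all of these
  -- values.
  set L : ℝ := ∑ i ∈ Finset.range M₀, ‖lam i‖ with hL
  have hbig : ∀ᶠ N : ℕ in atTop, L < ((N : ℝ) + 1 / 2) ^ 2 := by
    filter_upwards [eventually_ge_atTop ⌈L⌉₊, eventually_ge_atTop 1] with N hN hN1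
    have h1 : L ≤ N := Nat.ceil_le.1 hN
    have h2 : (1 : ℝ) ≤ N := by exact_mod_cast hN1
    nlinarith
  have hkey : ∀ᶠ N : ℕ in atTop, ‖lam N‖ < ((N : ℝ) + 1 / 2) ^ 2 ∧
      ((N : ℝ) + 1 / 2) ^ 2 ≤ ‖lam (N + 1)‖ := by
    filter_upwards [hbig, eventually_encard_eq hq hlam, eventually_ge_atTop 1] with N hNL hcard hN1
    set R : ℝ := ((N : ℝ) + 1 / 2) ^ 2
    set A : Set ℕ := {n : ℕ | 1 ≤ n ∧ ‖lam n‖ < R} with hA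
    have hdown : ∀ j k, 1 ≤ j → j ≤ k → ‖lam k‖ < R → ‖lam j‖ < R := by
      intro j k _ hjk hk
      rcases lt_or_ge j M₀ with h | h
      · exact (Finset.single_le_sum (f := fun i => ‖lam i‖) (fun i _ => norm_nonneg _)
          (Finset.mem_range.2 h)).trans_lt hNL
      · exact (hmono j k h hjk).trans_lt hk
    constructor
    · by_contra hcon
      have hsub : A ⊆ (Finset.Ico 1 N : Finset ℕ) := by
        intro k hk
        rw [Finset.coe_Ico, Set.mem_Ico]
        refine ⟨hk.1, ?_⟩
        by_contra hNk
        exact hcon (hdown N k hN1 (not_lt.1 hNk) hk.2)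
      have h1 := Set.encard_le_encard hsub
      rw [hcard, Set.encard_coe_eq_coe_finsetCard, Nat.card_Ico] at h1
      have h2 : N ≤ N - 1 := by exact_mod_cast h1
      omega
    · by_contra hcon
      have hsub : ((Finset.Icc 1 (N + 1) : Finset ℕ) : Set ℕ) ⊆ A := by
        intro k hk
        rw [Finset.coe_Icc, Set.mem_Icc] at hk
        exact ⟨hk.1, hdown k (N + 1) hk.1 hk.2 (not_le.1 hcon)⟩
      have h1 := Set.encard_le_encard hsub
      rw [hcard, Set.encard_coe_eq_coe_finsetCard, Nat.card_Icc] at h1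
      have h2 : N + 1 + 1 - 1 ≤ N := by exact_mod_cast h1
      omega
  obtain ⟨N₀, hN₀⟩ := eventually_atTop.1 hkey
  filter_upwards [eventually_ge_atTop (N₀ + 1)] with n hn
  obtain ⟨k, rfl⟩ : ∃ k, n = k + 1 := ⟨n - 1, by omega⟩
  refine ⟨?_, (hN₀ (k + 1) (by omega)).1⟩
  have h1 := (hN₀ k (by omega)).2
  have h2 : (((k + 1 : ℕ) : ℝ) - 1 / 2) = (k : ℝ) + 1 / 2 := by push_cast; ring
  rwa [h2]

end Counting

end FrozenArgument

/-! ### Asymptotics of the eigenvalues with odd index -/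

namespace FrozenArgument

open MeasureTheory Filter Topology

theorem norm_sin_sub_self_le {u : ℂ} (hu : ‖u‖ ≤ 1) : ‖Complex.sin u - u‖ ≤ ‖u‖ ^ 2 := by
  have h1 := Complex.norm_exp_sub_one_sub_id_le (x := -u * Complex.I) (by simpa using hu)
  have h2 := Complex.norm_exp_sub_one_sub_id_le (x := u * Complex.I) (by simpa using hu)
  have h : Complex.sin u - u = ((Complex.exp (-u * Complex.I) - 1 - -u * Complex.I) -
      (Complex.exp (u * Complex.I) - 1 - u * Complex.I)) * Complex.I / 2 := by
    rw [Complex.sin]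
    linear_combination (-u) * Complex.I_sq
  simp only [norm_mul, norm_neg, Complex.norm_I, mul_one] at h1 h2
  rw [h, norm_div, norm_mul, Complex.norm_I, mul_one, Complex.norm_ofNat]
  have h3 := norm_sub_le (Complex.exp (-u * Complex.I) - 1 - -u * Complex.I)
    (Complex.exp (u * Complex.I) - 1 - u * Complex.I)
  linarith

theorem sin_odd_mul_pi_div_two_sq {n : ℕ} (hn : Odd n) :
    Real.cos (n * Real.pi / 2) = 0 ∧ Real.sin (n * Real.pi / 2) ^ 2 = 1 := by
  have hc : Real.cos (n * Real.pi / 2) = 0 := by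
    obtain ⟨k, rfl⟩ := hn
    rw [Real.cos_eq_zero_iff]
    exact ⟨k, by push_cast; ring⟩
  exact ⟨hc, by have := Real.sin_sq_add_cos_sq (n * Real.pi / 2); rw [hc] at this; linarith⟩

/-- Solving `2 w cos (π w / 2) + P = 0` for `w ^ 2` near an odd integer `n`, where `P` is close to
`P₀`. -/
theorem norm_sq_sub_le_of_cos_eq {n : ℕ} (hn : Odd n) {w P P₀ : ℂ} {K D : ℝ} (hK : 0 ≤ K)
    (hwD : n * ‖w - n‖ ≤ D) (hw4 : ‖w - n‖ ≤ 1 / 4)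
    (hP : ‖P - P₀‖ ≤ K * ‖w - n‖)
    (heq : 2 * w * Complex.cos (w * (Real.pi / 2 : ℝ)) + P = 0) :
    n * ‖w ^ 2 - n ^ 2 - ((2 * Real.sin (n * Real.pi / 2) / Real.pi : ℝ) : ℂ) * P₀‖ ≤
      (1 + 8 * D + K) * (2 * ‖P₀‖ + 2 * K * D / n) := by
  obtain ⟨hc, hs⟩ := sin_odd_mul_pi_div_two_sq hn
  have hpi3 := Real.pi_gt_three
  have hpi4 := Real.pi_lt_d2
  have hn1 : (1 : ℝ) ≤ n := by exact_mod_cast hn.pos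
  set σ : ℝ := Real.sin (n * Real.pi / 2) with hσ
  have hσabs : |σ| = 1 := by
    rw [← sq_abs] at hs
    exact (pow_eq_one_iff_of_nonneg (abs_nonneg _) two_ne_zero).1 hs
  set e : ℂ := w - n with he
  have hw : w = n + e := by rw [he]; ring
  have hpiC : (Real.pi : ℂ) ≠ 0 := by exact_mod_cast Real.pi_ne_zero
  have hsC : (σ : ℂ) ^ 2 = 1 := by exact_mod_cast hs
  set u : ℂ := e * (Real.pi / 2 : ℝ) with hu
  have hun : ‖u‖ = ‖e‖ * (Real.pi / 2) := by
    rw [hu, norm_mul, Complex.norm_real, Real.norm_eq_abs, abs_of_pos (by positivity)]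
  set S : ℂ := Complex.sin u with hS
  have he0 := norm_nonneg e
  have hη := norm_sin_sub_self_le (u := u) (by rw [hun]; nlinarith)
  have hD0 : 0 ≤ D := (by positivity : 0 ≤ n * ‖e‖).trans hwD
  have hcos : Complex.cos (w * (Real.pi / 2 : ℝ)) = -(σ * S) := by
    have h1 : w * (Real.pi / 2 : ℝ) = ((n * Real.pi / 2 : ℝ) : ℂ) + u := by
      rw [hu, hw]; push_cast; ring
    rw [h1, Complex.cos_add, ← Complex.ofReal_cos, ← Complex.ofReal_sin, hc]
    simp [hσ, hS]
  have hPS : P = 2 * σ * w * S := by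
    rw [hcos] at heq
    linear_combination heq
  have hwn : ‖w‖ ≤ 2 * n := by
    have h1 : ‖w‖ ≤ ‖(n : ℂ)‖ + ‖e‖ := hw ▸ norm_add_le _ _
    rw [Complex.norm_natCast] at h1
    linarith
  have hwn' : (n : ℝ) / 2 ≤ ‖w‖ := by
    have h1 : ‖(n : ℂ)‖ - ‖-e‖ ≤ ‖(n : ℂ) - -e‖ := norm_sub_norm_le _ _
    rw [Complex.norm_natCast, norm_neg, sub_neg_eq_add, ← hw] at h1
    linarith
  have hSlow : ‖e‖ / 2 ≤ ‖S‖ := by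
    have h1 : ‖u‖ - ‖u - S‖ ≤ ‖S‖ := by
      have := norm_sub_norm_le u (u - S)
      rwa [sub_sub_cancel] at this
    rw [norm_sub_rev] at h1
    have h2 : ‖u‖ ≤ 1 / 2 := by rw [hun]; nlinarith
    have h3 : ‖u‖ ^ 2 ≤ ‖u‖ * (1 / 2) := by
      rw [sq]; exact mul_le_mul_of_nonneg_left h2 (norm_nonneg _)
    have h4 : ‖e‖ * (3 / 2) ≤ ‖u‖ := by
      rw [hun]; exact mul_le_mul_of_nonneg_left (by linarith) he0
    linarith
  -- Bootstrap: `‖P‖ = 2 ‖w‖ ‖S‖ ≥ n ‖e‖ / 2`, so the mere boundedness of `n ‖e‖` improves to a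
  -- bound by `‖P₀‖` and `1 / n`.
  have hne : n * ‖e‖ ≤ 2 * ‖P₀‖ + 2 * K * D / n := by
    have h1 : ‖P‖ = 2 * (‖w‖ * ‖S‖) := by
      rw [hPS, norm_mul, norm_mul, norm_mul, Complex.norm_real, Real.norm_eq_abs, hσabs,
        Complex.norm_ofNat]
      ring
    have h2 : (n : ℝ) / 2 * (‖e‖ / 2) ≤ ‖w‖ * ‖S‖ :=
      mul_le_mul hwn' hSlow (by positivity) (norm_nonneg _)
    have h3 : ‖P‖ ≤ ‖P₀‖ + K * ‖e‖ := by
      have := norm_le_norm_add_norm_sub P₀ P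
      rw [norm_sub_rev] at this
      linarith
    have h4 : K * ‖e‖ ≤ K * D / n := by
      rw [mul_div_assoc]
      refine mul_le_mul_of_nonneg_left ?_ hK
      rw [le_div_iff₀ (by linarith)]
      linarith
    have h5 : 2 * K * D / n = 2 * (K * D / n) := by ring
    rw [h5]
    linarith
  -- By `P = 2 σ w S` and `σ ^ 2 = 1`, replacing `S` by `u` turns `(2 σ / π) P` into `2 w e`, and `w
  -- ^ 2 - n ^ 2 - 2 w e = -e ^ 2`.
  have hr : w ^ 2 - n ^ 2 - ((2 * σ / Real.pi : ℝ) : ℂ) * P₀ =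
      -e ^ 2 - (4 / Real.pi : ℝ) * (w * (S - u)) + (2 * σ / Real.pi : ℝ) * (P - P₀) := by
    rw [hPS, hu, hw]
    push_cast
    field_simp
    linear_combination (-8 * w * S) * hsC
  have hrn : ‖w ^ 2 - n ^ 2 - ((2 * σ / Real.pi : ℝ) : ℂ) * P₀‖ ≤ (1 + 8 * D + K) * ‖e‖ := by
    rw [hr]
    have h1 : ‖-e ^ 2‖ ≤ ‖e‖ := by
      rw [norm_neg, norm_pow]; nlinarith
    have h2 : ‖((4 / Real.pi : ℝ) : ℂ) * (w * (S - u))‖ ≤ 8 * D * ‖e‖ := by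
      rw [norm_mul, norm_mul, Complex.norm_real, Real.norm_eq_abs, abs_of_pos (by positivity)]
      have h3 : ‖w‖ * ‖S - u‖ ≤ 2 * n * (‖e‖ * (Real.pi / 2)) ^ 2 := by
        rw [← hun]
        exact mul_le_mul hwn hη (norm_nonneg _) (by positivity)
      have h4 : 4 / Real.pi * (‖w‖ * ‖S - u‖) ≤
          4 / Real.pi * (2 * n * (‖e‖ * (Real.pi / 2)) ^ 2) :=
        mul_le_mul_of_nonneg_left h3 (by positivity)
      have h5 : 4 / Real.pi * (2 * n * (‖e‖ * (Real.pi / 2)) ^ 2) =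
          2 * Real.pi * ‖e‖ * (n * ‖e‖) := by
        field_simp
        ring
      have h6 : 2 * Real.pi * ‖e‖ * (n * ‖e‖) ≤ 8 * ‖e‖ * D :=
        mul_le_mul (by nlinarith) hwD (by positivity) (by positivity)
      linarith
    have h7 : ‖((2 * σ / Real.pi : ℝ) : ℂ) * (P - P₀)‖ ≤ K * ‖e‖ := by
      rw [norm_mul, Complex.norm_real, Real.norm_eq_abs, abs_div, abs_mul, hσabs, abs_of_pos
        (by positivity : 0 < Real.pi)]
      refine (mul_le_of_le_one_left (norm_nonneg _) ?_).trans hP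
      rw [div_le_one Real.pi_pos]
      norm_num
      linarith
    have h8 := norm_add_le (-e ^ 2 - (4 / Real.pi : ℝ) * (w * (S - u)))
      ((2 * σ / Real.pi : ℝ) * (P - P₀))
    have h9 := norm_sub_le (-e ^ 2) ((4 / Real.pi : ℝ) * (w * (S - u)))
    linarith
  calc n * ‖w ^ 2 - n ^ 2 - ((2 * σ / Real.pi : ℝ) : ℂ) * P₀‖
      ≤ n * ((1 + 8 * D + K) * ‖e‖) := mul_le_mul_of_nonneg_left hrn (by positivity)
    _ = (1 + 8 * D + K) * (n * ‖e‖) := by ring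
    _ ≤ _ := mul_le_mul_of_nonneg_left hne (by positivity)

/-- A zero would also be a zero of `sinDiv z π`, and the only such point in the annulus is `n ^ 2`,
where `sin (n π / 2) = ±1`. -/
theorem sinDiv_half_pi_ne_zero {n : ℕ} (hn : Odd n) {z : ℂ}
    (h1 : ((n : ℝ) - 1 / 2) ^ 2 ≤ ‖z‖) (h2 : ‖z‖ < ((n : ℝ) + 1 / 2) ^ 2) :
    sinDiv z (Real.pi / 2) ≠ 0 := by
  intro h
  have hn1 : (1 : ℝ) ≤ n := by exact_mod_cast hn.pos
  have h0 : sinDiv z Real.pi = 0 := by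
    rw [← add_halves Real.pi, sinDiv_add_self, h, zero_mul]
  obtain ⟨m, hm, rfl⟩ := sinDiv_pi_eq_zero_iff.1 h0
  rw [norm_pow, Complex.norm_natCast] at h1 h2
  have h3 := (pow_le_pow_iff_left₀ (by linarith) (by positivity) two_ne_zero).1 h1
  have h4 := (pow_lt_pow_iff_left₀ (by positivity) (by positivity) two_ne_zero).1 h2
  have hmn : m = n := by
    have h5 : (n : ℝ) < (m + 1 : ℕ) := by push_cast; linarith
    have h6 : (m : ℝ) < (n + 1 : ℕ) := by push_cast; linarith
    have h7 := Nat.cast_lt.1 h5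
    have h8 := Nat.cast_lt.1 h6
    omega
  subst hmn
  have h5 := rho_mul_sinDiv ((m : ℂ) ^ 2) (Real.pi / 2)
  rw [h, mul_zero] at h5
  have h6 : Complex.sin (m * (Real.pi / 2 : ℝ)) = 0 := by
    rcases rho_eq_or_eq_neg (rfl : (m : ℂ) ^ 2 = (m : ℂ) ^ 2) with h' | h'
    · rw [h'] at h5; exact h5.symm
    · rw [h', neg_mul, Complex.sin_neg] at h5; exact neg_eq_zero.1 h5.symm
  have h7 : Real.sin (m * Real.pi / 2) = 0 := by
    have : (m : ℂ) * (Real.pi / 2 : ℝ) = ((m * Real.pi / 2 : ℝ) : ℂ) := by push_cast; ring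
    rw [this, ← Complex.ofReal_sin] at h6
    exact_mod_cast h6
  have h8 := (sin_odd_mul_pi_div_two_sq hn).2
  rw [h7] at h8
  norm_num at h8

/-- A zero of the characteristic function in the annulus around `n ^ 2`, `n` odd, has a square root
`w` near `n` that solves the reduced equation. -/
theorem exists_root_near_odd {q : ℝ → ℂ}
    (hq : MemLp q 2 (volume.restrict (Set.Ioo 0 Real.pi))) :
    ∃ D : ℝ, ∀ᶠ n : ℕ in atTop, Odd n → ∀ z : ℂ, ((n : ℝ) - 1 / 2) ^ 2 ≤ ‖z‖ →
      ‖z‖ < ((n : ℝ) + 1 / 2) ^ 2 → charDelta q (Real.pi / 2) z = 0 →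
      ∃ w : ℂ, w ^ 2 = z ∧ n * ‖w - n‖ ≤ D ∧ 2 * w * Complex.cos (w * (Real.pi / 2 : ℝ)) +
        sineTransform (fun t => q t + q (Real.pi - t)) (Real.pi / 2) w = 0 := by
  obtain ⟨M, hM0, hM⟩ := exists_odd_norm_rho_sub_le hq
  refine ⟨8 * M, ?_⟩
  filter_upwards [eventually_ge_atTop (⌈8 * M⌉₊ + 1)] with n hnM hn z hz1 hz2 hz
  have hnM' : 8 * M + 1 ≤ n := by
    have h1 : ((⌈8 * M⌉₊ + 1 : ℕ) : ℝ) ≤ n := Nat.cast_le.2 hnM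
    push_cast at h1
    linarith [Nat.le_ceil (8 * M)]
  have hs := sinDiv_half_pi_ne_zero hn hz1 hz2
  rw [charDelta_eq hq] at hz
  have hF := (mul_eq_zero.1 hz).resolve_left hs
  rw [← norm_rho_sq] at hz1 hz2
  have hr1 := (pow_le_pow_iff_left₀ (by linarith) (by positivity) two_ne_zero).1 hz1
  have hr2 := (pow_lt_pow_iff_left₀ (by positivity) (by positivity) two_ne_zero).1 hz2
  have hr0 : 0 < ‖rho z‖ := by linarith
  obtain ⟨m, -, hm⟩ := hM z (by linarith) hr0 (by
    rw [← norm_neg (∫ t in (0 : ℝ)..(Real.pi / 2), _), eq_neg_of_add_eq_zero_left hF])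
  -- Here `‖rho z‖ ≥ n - 1/2 ≥ n / 2`.
  have hDn : 4 * M / ‖rho z‖ ≤ 8 * M / n := by
    rw [div_le_div_iff₀ hr0 (by linarith)]
    nlinarith
  have hsmall : 4 * M / ‖rho z‖ < 1 / 2 := by
    rw [div_lt_iff₀ hr0]
    linarith
  have hmn : m.natAbs = n := by
    have h1 := abs_norm_sub_norm_le (rho z) m
    have h2 : ‖(m : ℂ)‖ = (m.natAbs : ℝ) := by
      rw [Complex.norm_intCast, Nat.cast_natAbs]; push_cast; rfl
    rw [h2] at h1
    have h3 := abs_lt.1 (h1.trans_lt (hm.trans_lt hsmall))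
    have h4 : (m.natAbs : ℝ) < (n + 1 : ℕ) := by push_cast; linarith [h3.1]
    have h5 : (n : ℝ) < (m.natAbs + 1 : ℕ) := by push_cast; linarith [h3.2]
    have h6 := Nat.cast_lt.1 h4
    have h7 := Nat.cast_lt.1 h5
    omega
  have hred : 2 * rho z * Complex.cos (rho z * (Real.pi / 2 : ℝ)) +
      sineTransform (fun t => q t + q (Real.pi - t)) (Real.pi / 2) (rho z) = 0 := by
    rw [← rho_mul_integral_mul_sinDiv]
    linear_combination rho z * hF
  have hfin : ∀ w : ℂ, ‖w - n‖ ≤ 4 * M / ‖rho z‖ → n * ‖w - n‖ ≤ 8 * M := by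
    intro w hw
    have h1 := hw.trans hDn
    rw [le_div_iff₀ (by linarith)] at h1
    linarith
  -- The chosen root may be near `-n`; the reduced equation is odd in `w`, so it persists under `w ↦
  -- -w`.
  rcases Int.natAbs_eq m with h | h
  · rw [hmn] at h
    rw [h, Int.cast_natCast] at hm
    exact ⟨rho z, rho_sq z, hfin _ hm, hred⟩
  · rw [hmn] at h
    rw [h, Int.cast_neg, Int.cast_natCast] at hm
    refine ⟨-rho z, by rw [neg_sq, rho_sq], hfin _ ?_, ?_⟩
    · rwa [← neg_add', norm_neg, ← sub_neg_eq_add]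
    · rw [sineTransform_neg, neg_mul, Complex.cos_neg]
      linear_combination -hred

theorem exists_asymptotics {q : ℝ → ℂ}
    (hq : MemLp q 2 (volume.restrict (Set.Ioo 0 Real.pi)))
    {lam : ℕ → ℂ} (hlam : IsSpectrumNumbering q (Real.pi / 2) lam) :
    ∃ C : ℝ, ∀ᶠ n : ℕ in atTop, Odd n →
      n * ‖lam n - n ^ 2 - ((2 * Real.sin (n * Real.pi / 2) / Real.pi : ℝ) : ℂ) *
        sineTransform (fun t => q t + q (Real.pi - t)) (Real.pi / 2) n‖ ≤
      C * (‖sineTransform (fun t => q t + q (Real.pi - t)) (Real.pi / 2) n‖ + 1 / n) := by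
  obtain ⟨D, hD⟩ := exists_root_near_odd hq
  obtain ⟨K, hK0, hK⟩ := exists_norm_sineTransform_sub_le (by positivity : 0 ≤ Real.pi / 2)
    (intervalIntegrable_symm hq)
  refine ⟨(1 + 8 * D + K) * (2 + 2 * K * D), ?_⟩
  filter_upwards [hD, eventually_norm_mem_annulus hq hlam, eventually_ge_atTop 1,
    eventually_ge_atTop ⌈4 * D⌉₊] with n hDn hann hn1 hn4 hn
  obtain ⟨w, hw, hwD, heq⟩ := hDn hn (lam n) hann.1 hann.2
    (charDelta_eq_zero_of_isSpectrumNumbering hq hlam hn1)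
  have hn0 : (0 : ℝ) < n := by exact_mod_cast hn1
  have hD0 : 0 ≤ D := (by positivity : 0 ≤ n * ‖w - n‖).trans hwD
  have hn4' : 4 * D ≤ n := Nat.ceil_le.1 hn4
  -- Follows from `n ‖w - n‖ ≤ D` and `4 D ≤ n`.
  have hw4 : ‖w - n‖ ≤ 1 / 4 := by
    by_contra hcon
    nlinarith [not_le.1 hcon]
  have hP := hK n w (by
    rw [Complex.ofReal_natCast]
    exact hw4.trans (by norm_num))
  simp only [Complex.ofReal_natCast] at hP
  have h := norm_sq_sub_le_of_cos_eq hn hK0 hwD hw4 hP heq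
  rw [hw] at h
  refine h.trans ?_
  rw [mul_assoc (1 + 8 * D + K)]
  refine mul_le_mul_of_nonneg_left ?_ (by positivity)
  set s := ‖sineTransform (fun t => q t + q (Real.pi - t)) (Real.pi / 2) n‖
  have hs : 0 ≤ s := norm_nonneg _
  have h1 : 2 * K * D / n = 2 * K * D * (1 / n) := by ring
  have h2 : 0 ≤ 2 * K * D * s := by positivity
  have h3 : 0 ≤ 2 * (1 / (n : ℝ)) := by positivity
  rw [h1]
  linarith

end FrozenArgument

theorem mainTheorem8 (q : ℝ → ℂ)
    (hq : MeasureTheory.MemLp q 2 (MeasureTheory.volume.restrict (Set.Ioo 0 Real.pi)))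
    (lam : ℕ → ℂ) (hlam : FrozenArgument.IsSpectrumNumbering q (Real.pi / 2) lam) :
    ∃ κ : ℕ → ℂ, Summable (fun n => ‖κ n‖ ^ 2) ∧
      ∀ n : ℕ, Odd n →
        lam n = (n : ℂ) ^ 2 +
          ((2 * Real.sin (n * Real.pi / 2) / Real.pi : ℝ) : ℂ) *
            (∫ t in (0 : ℝ)..(Real.pi / 2), (q t + q (Real.pi - t)) * (Real.sin (n * t) : ℂ)) +
          κ n / n := by
  have hsine : ∀ n : ℕ, (∫ t in (0 : ℝ)..(Real.pi / 2),
      (q t + q (Real.pi - t)) * (Real.sin (n * t) : ℂ)) =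
      FrozenArgument.sineTransform (fun t => q t + q (Real.pi - t)) (Real.pi / 2) n := by
    intro n
    simp [FrozenArgument.sineTransform]
  simp only [hsine]
  set P : ℕ → ℂ := fun n =>
    FrozenArgument.sineTransform (fun t => q t + q (Real.pi - t)) (Real.pi / 2) n
  have hPsum : Summable fun n => ‖P n‖ ^ 2 :=
    FrozenArgument.summable_norm_sineTransform_sq (by positivity) (by linarith [Real.pi_pos])
      (FrozenArgument.memLp_symm hq)
  -- For odd `n` the formula forces this value, so small indices need no estimate; even indices are
  -- set to 0 for summability.
  set κ : ℕ → ℂ := fun n => if Odd n then n * (lam n - n ^ 2 -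
    ((2 * Real.sin (n * Real.pi / 2) / Real.pi : ℝ) : ℂ) * P n) else 0 with hκ
  refine ⟨κ, ?_, ?_⟩
  · obtain ⟨C, hC⟩ := FrozenArgument.exists_asymptotics hq hlam
    have hinv : Summable fun n : ℕ => 1 / (n : ℝ) ^ 2 :=
      Real.summable_one_div_nat_pow.2 one_lt_two
    refine Summable.of_norm_bounded_eventually_nat ((hPsum.add hinv).mul_left (C ^ 2 * 2)) ?_
    filter_upwards [hC] with n hn
    rw [Real.norm_of_nonneg (by positivity)]
    by_cases hodd : Odd n
    · have h1 := hn hodd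
      have h2 : ‖κ n‖ ≤ C * (‖P n‖ + 1 / n) := by
        rw [hκ]
        simp only [hodd, if_true]
        rwa [norm_mul, Complex.norm_natCast]
      have h3 := pow_le_pow_left₀ (norm_nonneg _) h2 2
      rw [mul_pow] at h3
      refine h3.trans ?_
      rw [mul_assoc]
      refine mul_le_mul_of_nonneg_left ?_ (sq_nonneg _)
      rw [← one_div_pow]
      nlinarith [sq_nonneg (‖P n‖ - 1 / n)]
    · rw [hκ]
      simp only [hodd, if_false, norm_zero, zero_pow two_ne_zero]
      positivity
  · intro n hn
    have hn0 : (n : ℂ) ≠ 0 := by exact_mod_cast hn.pos.ne'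
    rw [hκ]
    simp only [hn, if_true]
    rw [mul_div_cancel_left₀ _ hn0]
    ring
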